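/- An instance of Min-Unique-Games$(q)$ on the complete graph with vertices $\{0,\dots,n-1\}$ consists of permutations $\pi_{uv}$ of the label set $\{0,\dots,q-1\}$, one for each ordered pair of distinct vertices, with $\pi_{vu}=\pi_{uv}^{-1}$. An assignment $x$ of labels to vertices violates the edge $uv$ if $x_v\neq\pi_{uv}(x_u)$. Let $\mathrm{OPT}$ be the minimum number of edges whose deletion leaves a set of constraints satisfied by some assignment. For every fixed $q\ge 1$ there are a randomized word-RAM program $P$ and constants $C,c$, depending only on $q$, such that the following holds for every real $\tau>0$ and every instance with $n\ge 1$ vertices. Given $n$, $\lceil 1/\tau\rceil$ and the table of the permutations, and run with words of $c\,(\lfloor\log_2(n+\lceil 1/\tau\rceil)\rfloor+1)$ bits, $P$ always halts within $C n^3+2^{C/\tau^4}$ steps, that is, in time $O(n^3)+2^{O(1/\tau^4)}$, and outputs an assignment; with probability at least $2/3$ the number of edges violated by this assignment is at most $(1+\tau)\,\mathrm{OPT}$. -/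

import Mathlib

namespace UGFull

/-! ### Unique games on the complete graph -/

/-- An instance with vertex set `Fin n` and label set `Fin q`: a permutation `perm u v` of the
labels for every ordered pair of distinct vertices, with `perm v u` inverse to `perm u v`.
The diagonal entries `perm u u` are never used. -/
structure Instance (n q : ℕ) where
  perm : Fin n → Fin n → Equiv.Perm (Fin q)
  symm : ∀ u v, u ≠ v → perm v u = (perm u v)⁻¹

namespace Instance

/-- The assignment `x` satisfies the constraint of the pair `(u, v)`. -/
def Satisfies {n q : ℕ} (I : Instance n q) (x : Fin n → Fin q) (u v : Fin n) : Prop :=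
  x v = I.perm u v (x u)

/-- A set of edges of the complete graph is a feasible solution if deleting it leaves a
satisfiable set of constraints. -/
def Feasible {n q : ℕ} (I : Instance n q) (D : Finset (Sym2 (Fin n))) : Prop :=
  D ⊆ (⊤ : SimpleGraph (Fin n)).edgeFinset ∧
    ∃ x : Fin n → Fin q, ∀ u v, u ≠ v → s(u, v) ∉ D → I.Satisfies x u v

/-- The least number of edges in a feasible solution. -/
noncomputable def opt {n q : ℕ} (I : Instance n q) : ℕ :=
  sInf {k | ∃ D : Finset (Sym2 (Fin n)), I.Feasible D ∧ D.card = k}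

open Classical in
/-- The edges whose constraint is violated by the assignment `x`. -/
noncomputable def violated {n q : ℕ} (I : Instance n q) (x : Fin n → Fin q) :
    Finset (Sym2 (Fin n)) :=
  (⊤ : SimpleGraph (Fin n)).edgeFinset.filter
    fun e => ∃ u v, e = s(u, v) ∧ ¬ I.Satisfies x u v

/-- The violated edges of an assignment form a feasible solution. -/
theorem feasible_violated {n q : ℕ} (I : Instance n q) (x : Fin n → Fin q) :
    I.Feasible (I.violated x) := by
  classical
  refine ⟨Finset.filter_subset _ _, x, fun u v huv hD => ?_⟩
  by_contra h
  exact hD (Finset.mem_filter.mpr ⟨by simpa using huv, u, v, rfl, h⟩)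

/-- The input table: cell `(u * n + v) * q + a` holds the label `perm u v a`, and all cells
beyond the table are `0`. -/
def table {n q : ℕ} (I : Instance n q) (i : ℕ) : ℕ :=
  if h : i / q / n < n ∧ i / q % n < n ∧ i % q < q then
    (I.perm ⟨i / q / n, h.1⟩ ⟨i / q % n, h.2.1⟩ ⟨i % q, h.2.2⟩ : ℕ)
  else 0

theorem table_apply {n q : ℕ} (I : Instance n q) (u v : Fin n) (a : Fin q) :
    I.table ((u * n + v) * q + a) = I.perm u v a := by
  have hq : 0 < q := a.pos
  have hn : 0 < n := u.pos
  have h1 : (((u : ℕ) * n + v) * q + a) / q = u * n + v := by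
    rw [add_comm, Nat.add_mul_div_right _ _ hq, Nat.div_eq_of_lt a.2, zero_add]
  have h2 : (((u : ℕ) * n + v) * q + a) % q = a := by
    rw [add_comm, Nat.add_mul_mod_self_right, Nat.mod_eq_of_lt a.2]
  have h3 : ((u : ℕ) * n + v) / n = u := by
    rw [add_comm, Nat.add_mul_div_right _ _ hn, Nat.div_eq_of_lt v.2, zero_add]
  have h4 : ((u : ℕ) * n + v) % n = v := by
    rw [add_comm, Nat.add_mul_mod_self_right, Nat.mod_eq_of_lt v.2]
  simp only [table, h1, h2, h3, h4, u.2, v.2, a.2, and_self, dite_true, Fin.eta]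

end Instance

/-! ### A randomized word RAM -/

/-- The memory of the machine: registers, and arrays addressed by the contents of registers.
A program mentions only finitely many registers and finitely many arrays. -/
structure Store where
  reg : ℕ → ℕ
  arr : ℕ → ℕ → ℕ

/-- The binary operations of the machine. -/
inductive BinOp where
  | add | sub | mul | div | mod | lt | eq

/-- The result of an operation on words of `b` bits: sums and products are taken modulo `2 ^ b`,
subtraction is cut off at `0`, and comparisons return `1` or `0`. -/
def BinOp.eval (b : ℕ) : BinOp → ℕ → ℕ → ℕ
  | .add, y, z => (y + z) % 2 ^ b
  | .sub, y, z => y - z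
  | .mul, y, z => (y * z) % 2 ^ b
  | .div, y, z => y / z
  | .mod, y, z => y % z
  | .lt, y, z => if y < z then 1 else 0
  | .eq, y, z => if y = z then 1 else 0

/-- Programs. -/
inductive Cmd where
  /-- do nothing -/
  | skip
  /-- register `x` := the constant `c` -/
  | const (x c : ℕ)
  /-- register `x` := register `y` -/
  | move (x y : ℕ)
  /-- register `x` := `f` (register `y`) (register `z`) -/
  | op (f : BinOp) (x y z : ℕ)
  /-- register `x` := array `a` at the address in register `y` -/
  | load (x a y : ℕ)
  /-- array `a` at the address in register `y` := register `x` -/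
  | write (a y x : ℕ)
  /-- register `x` := a fresh uniformly random element of `{0, …, register y}` -/
  | rand (x y : ℕ)
  /-- first `c`, then `d` -/
  | seq (c d : Cmd)
  /-- `c` if register `x` is nonzero, otherwise `d` -/
  | cond (x : ℕ) (c d : Cmd)
  /-- while register `x` is nonzero, do `c` -/
  | loop (x : ℕ) (c : Cmd)

/-- Overwrite a register. -/
def Store.setReg (s : Store) (x w : ℕ) : Store :=
  { s with reg := Function.update s.reg x w }

/-- Overwrite an array cell. -/
def Store.setArr (s : Store) (a i w : ℕ) : Store :=
  { s with arr := Function.update s.arr a (Function.update (s.arr a) i w) }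

/-- A configuration: the commands that are still to be executed, and the memory.
The machine has halted when no command is left. -/
abbrev Config := List Cmd × Store

/-- One step of the machine with words of `b` bits. -/
noncomputable def step (b : ℕ) : Config → PMF Config
  | ([], s) => PMF.pure ([], s)
  | (.skip :: K, s) => PMF.pure (K, s)
  | (.const x c :: K, s) => PMF.pure (K, s.setReg x (c % 2 ^ b))
  | (.move x y :: K, s) => PMF.pure (K, s.setReg x (s.reg y))
  | (.op f x y z :: K, s) => PMF.pure (K, s.setReg x (f.eval b (s.reg y) (s.reg z)))
  | (.load x a y :: K, s) => PMF.pure (K, s.setReg x (s.arr a (s.reg y)))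
  | (.write a y x :: K, s) => PMF.pure (K, s.setArr a (s.reg y) (s.reg x))
  | (.rand x y :: K, s) =>
      (PMF.uniformOfFinset (Finset.range (s.reg y + 1)) ⟨0, by simp⟩).map
        fun w => (K, s.setReg x w)
  | (.seq c d :: K, s) => PMF.pure (c :: d :: K, s)
  | (.cond x c d :: K, s) => PMF.pure (if s.reg x ≠ 0 then c :: K else d :: K, s)
  | (.loop x c :: K, s) => PMF.pure (if s.reg x ≠ 0 then c :: .loop x c :: K else K, s)

/-- The distribution of the configuration after `t` steps. -/
noncomputable def run (b : ℕ) : ℕ → Config → PMF Config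
  | 0, C => PMF.pure C
  | t + 1, C => (step b C).bind (run b t)

/-- The initial memory on input `I` with accuracy parameter `k`: register `0` holds `n`,
register `1` holds `k`, array `0` holds the table of the permutations, the rest is `0`. -/
def input {n q : ℕ} (I : Instance n q) (k : ℕ) : Store where
  reg x := if x = 0 then n else if x = 1 then k else 0
  arr a i := if a = 0 then I.table i else 0

/-- The machine has halted and cells `0, …, n - 1` of array `1` hold the assignment `x`. -/
def Outputs {n q : ℕ} (C : Config) (x : Fin n → Fin q) : Prop :=
  C.1 = [] ∧ ∀ v : Fin n, C.2.arr 1 v = x v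

end UGFull

/-!
The program evaluates two families of candidate assignments, keeps the cheapest candidate, and one
of the families contains an assignment of cost at most `(1 + 1 / k) * OPT`, where `k = ⌈1 / τ⌉`.
Costs count ordered pairs, so the cost of an assignment is twice the number of violated edges.

*Few violations.* Let the optimum `x` cost at most `(n - 1) ^ 2 / (40 k)`. Some vertex `u` lies on
at most an average number of violated edges, and so the labels propagated from `u` along its edges
agree with `x` except at few vertices. Relabelling every vertex greedily against the propagated
labels changes `x` only at vertices where `x` itself violates a constant fraction of the edges, for
two labels of a vertex never satisfy the same edge. The number of changed vertices is therefore
`O(OPT / n)`, and the second-order effects of the change are `O(OPT ^ 2 / n ^ 2) ≤ OPT / k`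
(`exists_pivotReply_cost_le`). There are `n * q` such candidates, each takes time `O(n ^ 2)`.

*Many violations.* Otherwise an additive error of order `n ^ 2 / k ^ 2` is affordable. Choose
`T = s ^ 3` random vertices, with `s` of order `k ^ 2`, guess the labels of the first `s ^ 2` of
them, and label each later one greedily against those before it. Every later time `t` of this
process defines a whole assignment, its *policy*: the greedy labels against the first `t` sampled
vertices. The candidate labels each vertex by the policy of an independent random time. Its expected
cost is at most the average of the mutual costs of the policies, up to the negligible contribution
of the first `s ^ 2` times, and this average (the `energy`) hardly exceeds the cost of `x` when the
guess agrees with `x`: a greedy policy is at least as good against the average of the previous ones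
as that average is against itself, up to sampling errors (`energy_succ_le`). The sampling errors are
martingales with bounded increments, hence of order `√t` (`expect_deviation_sq_le`), and their total
effect telescopes to `O(n ^ 2 / √(s ^ 2)) = O(n ^ 2 / s)` (`expect_cost_sampleReply_le`). Markov's
inequality turns the expectation into a probability of at least `2 / 3` (`exists_good_samples`). Only
the sample and the random times are random; the program tries all `q ^ (s ^ 2) = 2 ^ O(k ^ 4)`
guesses, each in time `O(n ^ 2)` times a polynomial in `s`.

*The program.* The deterministic commands are verified with a relation `Exec` that counts steps and
Hoare-style rules for the predicate `Within`; the two loops that draw random numbers are shown to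
produce uniformly distributed arrays (`run_fill`), so that the program's output is the image of a
uniform sample (`run_program`). The running time is `O(n ^ 3) + n ^ 2 * Y` with `Y = 2 ^ O(k ^ 4)`,
and `n ^ 2 * Y ≤ n ^ 3 + Y ^ 3`.
-/

namespace UGFull

/-! ### Violations and replies -/

namespace Instance

variable {n q : ℕ}

/-- `1` if labelling `v` by `a` and `w` by `b` violates the edge `vw`, otherwise `0`; in particular
`0` if `v = w`. -/
def viol (I : Instance n q) (v : Fin n) (a : Fin q) (w : Fin n) (b : Fin q) : ℕ :=
  if v ≠ w ∧ I.perm v w a ≠ b then 1 else 0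

theorem viol_le_one (I : Instance n q) (v : Fin n) (a : Fin q) (w : Fin n) (b : Fin q) :
    I.viol v a w b ≤ 1 := by
  unfold viol; split_ifs <;> simp

theorem viol_self (I : Instance n q) (v : Fin n) (a b : Fin q) : I.viol v a v b = 0 := by
  simp [viol]

theorem viol_comm (I : Instance n q) (v : Fin n) (a : Fin q) (w : Fin n) (b : Fin q) :
    I.viol v a w b = I.viol w b v a := by
  unfold viol
  by_cases h : v = w
  · simp [h]
  · have h' : w ≠ v := fun e => h e.symm
    have : I.perm v w a = b ↔ I.perm w v b = a := by
      rw [I.symm v w h, Equiv.Perm.inv_eq_iff_eq, eq_comm]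
    simp [h, h', this]

/-- The number of ordered pairs of vertices, labelled by `x` and `y`, whose constraint is
violated. -/
def pairCost (I : Instance n q) (x y : Fin n → Fin q) : ℕ :=
  ∑ v, ∑ w, I.viol v (x v) w (y w)

/-- The number of ordered pairs violated by `x`: twice the number of violated edges. -/
def cost (I : Instance n q) (x : Fin n → Fin q) : ℕ := I.pairCost x x

theorem pairCost_comm (I : Instance n q) (x y : Fin n → Fin q) :
    I.pairCost x y = I.pairCost y x := by
  unfold pairCost
  rw [Finset.sum_comm]
  exact Finset.sum_congr rfl fun v _ => Finset.sum_congr rfl fun w _ => I.viol_comm _ _ _ _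

theorem pairCost_le (I : Instance n q) (x y : Fin n → Fin q) : I.pairCost x y ≤ n ^ 2 := by
  calc I.pairCost x y ≤ ∑ _v : Fin n, ∑ _w : Fin n, 1 :=
        Finset.sum_le_sum fun v _ => Finset.sum_le_sum fun w _ => I.viol_le_one _ _ _ _
    _ = n ^ 2 := by simp [sq]

theorem cost_eq_two_mul_card (I : Instance n q) (x : Fin n → Fin q) :
    I.cost x = 2 * (I.violated x).card := by
  classical
  let G : SimpleGraph (Fin n) :=
    { Adj := fun v w => v ≠ w ∧ I.perm v w (x v) ≠ x w
      symm := ⟨fun v w h => by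
        have := I.viol_comm v (x v) w (x w)
        unfold viol at this
        rw [if_pos h] at this
        by_contra h'
        rw [if_neg h'] at this
        exact one_ne_zero this⟩
      loopless := ⟨fun v h => h.1 rfl⟩ }
  have h1 : I.violated x = G.edgeFinset := by
    ext e
    induction e with
    | _ v w =>
      rw [violated, Finset.mem_filter, SimpleGraph.mem_edgeFinset, SimpleGraph.mem_edgeFinset,
        SimpleGraph.mem_edgeSet, SimpleGraph.mem_edgeSet, SimpleGraph.top_adj]
      constructor
      · rintro ⟨hvw, u, u', he, hn⟩
        rcases Sym2.eq_iff.1 he with ⟨rfl, rfl⟩ | ⟨rfl, rfl⟩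
        · exact ⟨hvw, fun h => hn h.symm⟩
        · exact SimpleGraph.Adj.symm (G := G) ⟨hvw.symm, fun h => hn h.symm⟩
      · intro h
        exact ⟨h.1, v, w, rfl, fun h' => h.2 h'.symm⟩
  rw [h1, ← G.sum_degrees_eq_twice_card_edges]
  rw [cost, pairCost]
  refine Finset.sum_congr rfl fun v _ => ?_
  rw [← SimpleGraph.card_neighborFinset_eq_degree, Finset.card_eq_sum_ones,
    SimpleGraph.neighborFinset_eq_filter, Finset.sum_filter]
  rfl

theorem opt_le (I : Instance n q) (x : Fin n → Fin q) : I.opt ≤ (I.violated x).card :=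
  Nat.sInf_le ⟨_, I.feasible_violated x, rfl⟩

theorem exists_card_violated_eq_opt [NeZero q] (I : Instance n q) :
    ∃ x : Fin n → Fin q, (I.violated x).card = I.opt := by
  have hne : {k | ∃ D : Finset (Sym2 (Fin n)), I.Feasible D ∧ D.card = k}.Nonempty :=
    ⟨_, _, I.feasible_violated fun _ => 0, rfl⟩
  obtain ⟨D, ⟨hD, x, hx⟩, hc⟩ := Nat.sInf_mem hne
  refine ⟨x, le_antisymm ?_ (I.opt_le x)⟩
  rw [opt, ← hc]
  refine Finset.card_le_card fun e he => ?_
  classical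
  simp only [violated, Finset.mem_filter, SimpleGraph.mem_edgeFinset] at he
  obtain ⟨he1, u, v, rfl, hn⟩ := he
  by_contra hD'
  exact hn (hx u v (by simpa using he1) hD')

/-- The number of the first `t` vertices of the list `U`, labelled by `Y`, whose edge to `v` is
violated if `v` is labelled `a`. -/
def conflicts (I : Instance n q) (U : ℕ → Fin n) (Y : ℕ → Fin q) (t : ℕ) (v : Fin n)
    (a : Fin q) : ℕ :=
  ∑ j ∈ Finset.range t, I.viol v a (U j) (Y j)

theorem conflicts_le (I : Instance n q) (U : ℕ → Fin n) (Y : ℕ → Fin q) (t : ℕ) (v : Fin n)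
    (a : Fin q) : I.conflicts U Y t v a ≤ t := by
  calc I.conflicts U Y t v a ≤ ∑ _j ∈ Finset.range t, 1 :=
        Finset.sum_le_sum fun j _ => I.viol_le_one _ _ _ _
    _ = t := by simp

end Instance

/-- The first label at which `f` is least. -/
def firstMin {q : ℕ} [NeZero q] (f : Fin q → ℕ) : Fin q :=
  (Finset.univ.filter fun a => ∀ b, f a ≤ f b).min' <| by
    obtain ⟨a, ha⟩ := Finite.exists_min f
    exact ⟨a, by simpa using ha⟩

theorem firstMin_le {q : ℕ} [NeZero q] (f : Fin q → ℕ) (b : Fin q) : f (firstMin f) ≤ f b := by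
  have := Finset.min'_mem (Finset.univ.filter fun a => ∀ b, f a ≤ f b) (by
    obtain ⟨a, ha⟩ := Finite.exists_min f
    exact ⟨a, by simpa using ha⟩)
  exact (Finset.mem_filter.1 this).2 b

theorem eq_firstMin {q : ℕ} [NeZero q] (f : Fin q → ℕ) (a : Fin q) (h : ∀ b, f a ≤ f b)
    (h' : ∀ b, b < a → f a < f b) : a = firstMin f := by
  apply le_antisymm
  · by_contra hlt
    exact absurd (firstMin_le f a) (not_le.2 (h' _ (not_le.1 hlt)))
  · exact Finset.min'_le _ _ (by simpa using h)

namespace Instance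

variable {n q : ℕ}

/-- The greedy label of `v` against the first `t` vertices of `U`, labelled by `Y`. -/
def reply [NeZero q] (I : Instance n q) (U : ℕ → Fin n) (Y : ℕ → Fin q) (t : ℕ) (v : Fin n) :
    Fin q :=
  firstMin (I.conflicts U Y t v)

theorem conflicts_congr (I : Instance n q) {U U' : ℕ → Fin n} {Y Y' : ℕ → Fin q} {t : ℕ}
    (hU : ∀ j < t, U j = U' j) (hY : ∀ j < t, Y j = Y' j) :
    I.conflicts U Y t = I.conflicts U' Y' t := by
  funext v a
  refine Finset.sum_congr rfl fun j hj => ?_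
  rw [hU j (Finset.mem_range.1 hj), hY j (Finset.mem_range.1 hj)]

theorem reply_congr [NeZero q] (I : Instance n q) {U U' : ℕ → Fin n} {Y Y' : ℕ → Fin q} {t : ℕ}
    (hU : ∀ j < t, U j = U' j) (hY : ∀ j < t, Y j = Y' j) :
    I.reply U Y t = I.reply U' Y' t := by
  funext v
  rw [reply, reply, I.conflicts_congr hU hY]

/-! ### Pivoting when few edges are violated -/

/-- The labels that satisfy all edges at `u`, given the label `a` of `u`. -/
def pivot (I : Instance n q) (u : Fin n) (a : Fin q) (w : Fin n) : Fin q :=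
  if w = u then a else I.perm u w a

/-- The number of edges at `v` that are violated if `v` is labelled `a` and the other vertices
are labelled by `x`. -/
def degreeCost (I : Instance n q) (x : Fin n → Fin q) (v : Fin n) (a : Fin q) : ℕ :=
  ∑ w, I.viol v a w (x w)

/-- The greedy labels against the labels propagated from `u`. -/
def pivotReply [NeZero q] (I : Instance n q) (u : Fin n) (a : Fin q) (v : Fin n) : Fin q :=
  firstMin (I.degreeCost (I.pivot u a) v)

theorem degreeCost_le_add (I : Instance n q) (x y : Fin n → Fin q) (v : Fin n) (a : Fin q) :
    I.degreeCost y v a ≤ I.degreeCost x v a + (Finset.univ.filter fun w => y w ≠ x w).card := by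
  rw [degreeCost, degreeCost, Finset.card_filter, ← Finset.sum_add_distrib]
  refine Finset.sum_le_sum fun w _ => ?_
  by_cases h : y w = x w
  · simp [h]
  · have := I.viol_le_one v a w (y w)
    simp only [ne_eq, h, not_false_eq_true, if_true]
    omega

/-- Two labels of `v` cannot satisfy the same edge. -/
theorem pred_le_degreeCost_add (I : Instance n q) (x : Fin n → Fin q) (v : Fin n) {a b : Fin q}
    (hab : a ≠ b) : n - 1 ≤ I.degreeCost x v a + I.degreeCost x v b := by
  have : (Finset.univ.erase v).card = n - 1 := by
    rw [Finset.card_erase_of_mem (Finset.mem_univ v), Finset.card_univ, Fintype.card_fin]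
  rw [degreeCost, degreeCost, ← Finset.sum_add_distrib, ← this, Finset.card_eq_sum_ones]
  refine le_trans (Finset.sum_le_sum fun w hw => ?_)
    (Finset.sum_le_sum_of_subset (Finset.erase_subset v _))
  have hvw : v ≠ w := (Finset.ne_of_mem_erase hw).symm
  unfold viol
  by_cases h1 : I.perm v w a = x w
  · have h2 : I.perm v w b ≠ x w := fun h => hab ((I.perm v w).injective (h1.trans h.symm))
    simp [hvw, h1, h2]
  · simp [hvw, h1]

/-- When `x` violates at most a fraction of about `1 / (40 k)` of the edges, the greedy labels of
some pivot cost at most `1 + 1 / k` times as much as `x`. -/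
theorem exists_pivotReply_cost_le [NeZero q] (I : Instance n q) (hn : 1 ≤ n) (x : Fin n → Fin q)
    (k : ℕ) (hk : 1 ≤ k) (hx : 40 * k * I.cost x ≤ (n - 1) ^ 2) :
    ∃ u a, k * I.cost (I.pivotReply u a) ≤ (k + 1) * I.cost x := by
  set m := n - 1 with hm
  set b : Fin n → ℕ := fun v => I.degreeCost x v (x v) with hb
  have hV : I.cost x = ∑ v, b v := rfl
  have : NeZero n := ⟨by omega⟩
  -- a pivot at which `x` violates at most an average number of edges
  obtain ⟨u, -, hu⟩ : ∃ u ∈ Finset.univ, n * b u ≤ I.cost x := by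
    apply Finset.exists_le_of_sum_le (Finset.univ_nonempty (α := Fin n))
    rw [← Finset.mul_sum, ← hV]
    simp
  refine ⟨u, x u, ?_⟩
  set y := I.pivot u (x u) with hy
  set z := I.pivotReply u (x u) with hz
  set D := (Finset.univ.filter fun w => y w ≠ x w).card with hD
  have hDb : D ≤ b u := by
    rw [hD, Finset.card_filter, hb]
    refine Finset.sum_le_sum fun w _ => ?_
    by_cases h : y w = x w
    · simp [h]
    · have huw : w ≠ u := by
        rintro rfl
        exact h (by simp [hy, pivot])
      have : I.perm u w (x u) ≠ x w := by
        intro h'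
        exact h (by simp [hy, pivot, huw, h'])
      simp [h, viol, huw.symm, this]
  have hD' : (Finset.univ.filter fun w => x w ≠ y w).card = D := by
    rw [hD]; congr 1; ext w; simp [eq_comm]
  set G := Finset.univ.filter fun v => z v ≠ x v with hG
  have hzy : ∀ v, I.degreeCost y v (z v) ≤ I.degreeCost y v (x v) := fun v => firstMin_le _ _
  have hzx : ∀ v, I.degreeCost x v (z v) ≤ b v + 2 * D := by
    intro v
    have h1 := I.degreeCost_le_add y x v (z v)
    have h2 := I.degreeCost_le_add x y v (x v)
    have h3 := hzy v
    rw [hD'] at h1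
    change _ ≤ b v + D at h2
    omega
  have hGb : ∀ v ∈ G, m ≤ 2 * b v + 2 * D := by
    intro v hv
    have h1 := I.pred_le_degreeCost_add x v (Finset.mem_filter.1 hv).2
    have h2 := hzx v
    change m ≤ _ + b v at h1
    omega
  have hGm : G.card * m ≤ 2 * I.cost x + 2 * D * G.card := by
    calc G.card * m = ∑ _v ∈ G, m := by simp
      _ ≤ ∑ v ∈ G, (2 * b v + 2 * D) := Finset.sum_le_sum hGb
      _ = 2 * ∑ v ∈ G, b v + 2 * D * G.card := by
        rw [Finset.sum_add_distrib, ← Finset.mul_sum]; simp [mul_comm]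
      _ ≤ _ := by
        rw [hV]
        gcongr
        exact Finset.subset_univ G
  -- A pair with one end in `G` changes by what its end in `G` contributes, which `hzx` bounds
  -- after summation over the other end; for a pair inside `G` adding both contributions is off by
  -- at most `2`.
  have hcost : I.cost z ≤ I.cost x + 4 * D * G.card + 2 * G.card ^ 2 := by
    have key : ∀ v w, (I.viol v (z v) w (z w) : ℤ) ≤ I.viol v (x v) w (x w) +
        (if v ∈ G then (I.viol v (z v) w (x w) - I.viol v (x v) w (x w) : ℤ) else 0) +
        (if w ∈ G then (I.viol w (z w) v (x v) - I.viol w (x w) v (x v) : ℤ) else 0) +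
        2 * ((if v ∈ G then 1 else 0) * (if w ∈ G then 1 else 0)) := by
      intro v w
      have e1 := I.viol_comm v (x v) w (x w)
      have e2 := I.viol_comm v (x v) w (z w)
      have l1 := I.viol_le_one v (z v) w (z w)
      have l2 := I.viol_le_one v (x v) w (x w)
      have z1 : v ∉ G → z v = x v := by simp [hG]
      have z2 : w ∉ G → z w = x w := by simp [hG]
      by_cases hv : v ∈ G <;> by_cases hw : w ∈ G
      · simp only [hv, hw, if_true]; omega
      · rw [z2 hw]; simp only [hv, hw, if_true, if_false]; omega
      · rw [z1 hv]; simp only [hv, hw, if_true, if_false]; omega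
      · rw [z1 hv, z2 hw]; simp only [hv, hw, if_false]; omega
    have half : ∀ v, ∑ w, (if v ∈ G then
        (I.viol v (z v) w (x w) - I.viol v (x v) w (x w) : ℤ) else 0) ≤
        if v ∈ G then (2 * D : ℤ) else 0 := by
      intro v
      split_ifs
      · have := hzx v
        simp only [hb, degreeCost] at this
        rw [Finset.sum_sub_distrib]
        zify at this
        linarith
      · simp
    have hsum : (I.cost z : ℤ) ≤ I.cost x + (∑ v, if v ∈ G then (2 * D : ℤ) else 0) +
        (∑ v, if v ∈ G then (2 * D : ℤ) else 0) +
        2 * ((∑ v, if v ∈ G then 1 else 0) * ∑ v, if v ∈ G then 1 else 0) := by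
      calc (I.cost z : ℤ) = ∑ v, ∑ w, (I.viol v (z v) w (z w) : ℤ) := by
            simp [cost, pairCost]
        _ ≤ ∑ v, ∑ w, _ := Finset.sum_le_sum fun v _ => Finset.sum_le_sum fun w _ => key v w
        _ ≤ _ := by
          simp only [Finset.sum_add_distrib, ← Finset.mul_sum]
          refine add_le_add (add_le_add (add_le_add ?_ ?_) ?_) ?_
          · simp [cost, pairCost]
          · exact Finset.sum_le_sum fun v _ => half v
          · rw [Finset.sum_comm]
            exact Finset.sum_le_sum fun v _ => half v
          · rw [← Finset.sum_mul]
    simp only [Finset.sum_ite_mem, Finset.univ_inter, Finset.sum_const, nsmul_eq_mul,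
      mul_one] at hsum
    zify
    linarith
  rcases Nat.eq_zero_or_pos m with h0 | hmpos
  · have h1 : n = 1 := by omega
    subst h1
    have : I.cost z = 0 := by simp [cost, pairCost, viol_self]
    simp [this]
  · set V := I.cost x with hVdef
    set g := G.card with hg
    have hDm : m * D ≤ V := le_trans (Nat.mul_le_mul (by omega) hDb) hu
    zify at hx hGm hDm hcost hmpos hk ⊢
    have hD40 : (40 : ℤ) * D ≤ m := by
      by_contra h
      push Not at h
      have : (40 : ℤ) * (k * V) ≤ m ^ 2 := by linarith
      have h5 : (V : ℤ) ≤ k * V := by nlinarith [Nat.cast_nonneg (α := ℤ) V]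
      nlinarith
    have hgm : (19 : ℤ) * (g * m) ≤ 40 * V := by nlinarith [Nat.cast_nonneg (α := ℤ) g]
    have hg0 : (0 : ℤ) ≤ g := Nat.cast_nonneg _
    have hV0 : (0 : ℤ) ≤ V := Nat.cast_nonneg _
    have hmain : ((m : ℤ) ^ 2) * (4 * D * g + 2 * g ^ 2) ≤ 40 * V ^ 2 := by
      have a1 : ((m : ℤ) * D) * (19 * (g * m)) ≤ V * (40 * V) :=
        mul_le_mul hDm hgm (by positivity) hV0
      have a2 : (19 * ((g : ℤ) * m)) * (19 * (g * m)) ≤ (40 * V) * (40 * V) :=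
        mul_le_mul hgm hgm (by positivity) (by positivity)
      nlinarith [sq_nonneg (V : ℤ)]
    have hk2 : (k : ℤ) * (4 * D * g + 2 * g ^ 2) ≤ V := by
      have h2 : ((m : ℤ) ^ 2) * (k * (4 * D * g + 2 * g ^ 2)) ≤ (m : ℤ) ^ 2 * V := by
        calc ((m : ℤ) ^ 2) * (k * (4 * D * g + 2 * g ^ 2))
            = (k : ℤ) * (((m : ℤ) ^ 2) * (4 * D * g + 2 * g ^ 2)) := by ring
          _ ≤ (k : ℤ) * (40 * V ^ 2) := by gcongr
          _ = (40 * (k : ℤ) * V) * V := by ring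
          _ ≤ (m : ℤ) ^ 2 * V := by gcongr
      exact le_of_mul_le_mul_left h2 (by positivity)
    nlinarith

end Instance

/-! ### Expectations over uniform families -/

/-- Resampling one coordinate of a uniform family does not change its distribution. -/
theorem expect_expect_update {ι α : Type*} [Fintype ι] [DecidableEq ι] [Fintype α] [Nonempty α]
    (i : ι) (G : (ι → α) → ℝ) :
    Finset.expect Finset.univ (fun u => Finset.expect Finset.univ fun w =>
      G (Function.update u i w)) = Finset.expect Finset.univ G := by
  have hinv : Function.Involutive
      (fun p : (ι → α) × α => (Function.update p.1 i p.2, p.1 i)) := fun p => by simp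
  have h1 : Finset.expect Finset.univ (fun p : (ι → α) × α => G (Function.update p.1 i p.2)) =
      Finset.expect Finset.univ fun p : (ι → α) × α => G p.1 :=
    Fintype.expect_equiv hinv.toPerm _ _ fun _ => rfl
  rw [← Finset.univ_product_univ, Finset.expect_product, Finset.expect_product] at h1
  simpa [Fintype.expect_const] using h1

/-- Distinct coordinates of a uniform family are independent and uniform. -/
theorem expect_two_coordinates {ι α : Type*} [Fintype ι] [DecidableEq ι] [Fintype α] [Nonempty α]
    {i j : ι} (hij : i ≠ j) (G : α → α → ℝ) :
    Finset.expect Finset.univ (fun r : ι → α => G (r i) (r j)) =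
      Finset.expect Finset.univ fun a => Finset.expect Finset.univ fun b => G a b := by
  rw [← expect_expect_update i, ← expect_expect_update j]
  simp only [Function.update_self, Function.update_of_ne hij.symm]
  rw [Finset.expect_congr rfl fun u _ => Finset.expect_comm _ _ _]
  simp

/-- Markov's inequality for the uniform distribution. -/
theorem card_lt_mul_le_of_expect_le {Ω : Type*} [Fintype Ω] [Nonempty Ω] (f : Ω → ℝ) {ε : ℝ}
    (hε : 0 < ε) (hf : ∀ ω, 0 ≤ f ω) (h : Finset.expect Finset.univ f ≤ ε) :
    3 * ((Finset.univ.filter fun ω => 3 * ε < f ω).card : ℝ) ≤ Fintype.card Ω := by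
  have hsum : ∑ ω, f ω ≤ ε * Fintype.card Ω := by
    rw [Fintype.expect_eq_sum_div_card, div_le_iff₀ (by positivity)] at h
    exact h
  have : ∑ ω ∈ Finset.univ.filter (fun ω => 3 * ε < f ω), 3 * ε ≤ ∑ ω, f ω :=
    le_trans (Finset.sum_le_sum fun ω hω => (Finset.mem_filter.1 hω).2.le)
      (Finset.sum_le_sum_of_subset_of_nonneg (Finset.subset_univ _) fun ω _ _ => hf ω)
  rw [Finset.sum_const, nsmul_eq_mul] at this
  have h3 : ε * (3 * ((Finset.univ.filter fun ω => 3 * ε < f ω).card : ℝ)) ≤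
      ε * Fintype.card Ω := by linarith
  exact le_of_mul_le_mul_left h3 hε

/-! ### Labelling a random sample greedily -/

namespace Instance

variable {n q : ℕ}

/-- The labels of the sampled vertices `U` after `t` of them have been labelled: the first `t₀`
are labelled by the guess `d`, each later one greedily against those before it. -/
def sampleLabels [NeZero q] (I : Instance n q) (d : ℕ → Fin q) (t₀ : ℕ) (U : ℕ → Fin n) :
    ℕ → ℕ → Fin q
  | 0 => fun _ => 0
  | t + 1 => Function.update (sampleLabels I d t₀ U t) t
      (if t < t₀ then d t else I.reply U (sampleLabels I d t₀ U t) t (U t))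

theorem sampleLabels_of_lt [NeZero q] (I : Instance n q) (d : ℕ → Fin q) (t₀ : ℕ)
    (U : ℕ → Fin n) {j t t' : ℕ} (h : j < t) (htt' : t ≤ t') :
    I.sampleLabels d t₀ U t' j = I.sampleLabels d t₀ U t j := by
  induction t', htt' using Nat.le_induction with
  | base => rfl
  | succ t' ht ih => rw [sampleLabels, Function.update_of_ne (by omega), ih]

theorem sampleLabels_congr [NeZero q] (I : Instance n q) {d d' : ℕ → Fin q} {t₀ : ℕ}
    {U U' : ℕ → Fin n} {t : ℕ} (hd : ∀ j < min t t₀, d j = d' j) (hU : ∀ j < t, U j = U' j) :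
    I.sampleLabels d t₀ U t = I.sampleLabels d' t₀ U' t := by
  induction t with
  | zero => rfl
  | succ t ih =>
    have ih' := ih (fun j hj => hd j (by omega)) (fun j hj => hU j (by omega))
    rw [sampleLabels, sampleLabels, ih', hU t (by omega),
      I.reply_congr (fun j hj => hU j (by omega)) (fun _ _ => rfl)]
    by_cases h : t < t₀
    · simp only [h, if_true, hd t (by omega)]
    · simp only [h, if_false]

/-- The assignment in which every vertex `v` is labelled greedily against the first `r v`
vertices of the sample. -/
def sampleReply [NeZero q] (I : Instance n q) (d : ℕ → Fin q) (t₀ T : ℕ) (U : ℕ → Fin n)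
    (r : Fin n → ℕ) (v : Fin n) : Fin q :=
  I.reply U (I.sampleLabels d t₀ U T) (r v) v

/-- The labels that the `t`-th sampled vertex would receive, as a function of this vertex, when
the guess is the restriction of `x`. -/
def policy [NeZero q] (I : Instance n q) (x : Fin n → Fin q) (t₀ : ℕ) (U : ℕ → Fin n) (t : ℕ)
    (v : Fin n) : Fin q :=
  if t < t₀ then x v else I.reply U (I.sampleLabels (x ∘ U) t₀ U t) t v

theorem sampleLabels_succ [NeZero q] (I : Instance n q) (x : Fin n → Fin q) (t₀ : ℕ)
    (U : ℕ → Fin n) (t : ℕ) :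
    I.sampleLabels (x ∘ U) t₀ U (t + 1) =
      Function.update (I.sampleLabels (x ∘ U) t₀ U t) t (I.policy x t₀ U t (U t)) := rfl

theorem policy_congr [NeZero q] (I : Instance n q) (x : Fin n → Fin q) (t₀ : ℕ)
    {U U' : ℕ → Fin n} {t : ℕ} (hU : ∀ j < t, U j = U' j) :
    I.policy x t₀ U t = I.policy x t₀ U' t := by
  funext v
  rw [policy, policy, I.sampleLabels_congr (fun j hj => ?_) hU,
    I.reply_congr hU (fun _ _ => rfl)]
  simp [hU j (by omega)]

/-- The number of conflicts at `v` with the labelled sample exceeds its conditional expectation,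
the average number of conflicts with the policies so far, by this amount. -/
noncomputable def deviation [NeZero q] (I : Instance n q) (x : Fin n → Fin q) (t₀ : ℕ)
    (U : ℕ → Fin n) (t : ℕ) (v : Fin n) (a : Fin q) : ℝ :=
  I.conflicts U (I.sampleLabels (x ∘ U) t₀ U t) t v a -
    (∑ j ∈ Finset.range t, ∑ w, (I.viol v a w (I.policy x t₀ U j w) : ℝ)) / n

theorem deviation_congr [NeZero q] (I : Instance n q) (x : Fin n → Fin q) (t₀ : ℕ)
    {U U' : ℕ → Fin n} {t : ℕ} (hU : ∀ j < t, U j = U' j) (v : Fin n) (a : Fin q) :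
    I.deviation x t₀ U t v a = I.deviation x t₀ U' t v a := by
  rw [deviation, deviation, I.sampleLabels_congr (fun j hj => ?_) hU,
    I.conflicts_congr hU (fun _ _ => rfl)]
  · congr 2
    refine Finset.sum_congr rfl fun j hj => ?_
    rw [I.policy_congr x t₀ fun i hi => hU i (hi.trans (Finset.mem_range.1 hj))]
  · simp [hU j (by omega)]

theorem deviation_succ [NeZero q] (I : Instance n q) (x : Fin n → Fin q) (t₀ : ℕ)
    (U : ℕ → Fin n) (t : ℕ) (v : Fin n) (a : Fin q) :
    I.deviation x t₀ U (t + 1) v a = I.deviation x t₀ U t v a +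
      (I.viol v a (U t) (I.policy x t₀ U t (U t)) -
        (∑ w, (I.viol v a w (I.policy x t₀ U t w) : ℝ)) / n) := by
  have h : I.conflicts U (I.sampleLabels (x ∘ U) t₀ U (t + 1)) (t + 1) v a =
      I.conflicts U (I.sampleLabels (x ∘ U) t₀ U t) t v a +
        I.viol v a (U t) (I.policy x t₀ U t (U t)) := by
    rw [conflicts, Finset.sum_range_succ, sampleLabels_succ, Function.update_self]
    congr 1
    refine Finset.sum_congr rfl fun j hj => ?_
    rw [Function.update_of_ne (Finset.mem_range.1 hj).ne]
  rw [deviation, deviation, h, Finset.sum_range_succ]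
  push_cast
  ring

/-- A finite sequence of vertices, continued by the vertex `0`. -/
def extend [NeZero n] {T : ℕ} (u : Fin T → Fin n) (j : ℕ) : Fin n :=
  if h : j < T then u ⟨j, h⟩ else 0

theorem extend_update_of_ne [NeZero n] {T : ℕ} (u : Fin T → Fin n) (i : Fin T) (w : Fin n) {j : ℕ}
    (h : j ≠ i) : extend (Function.update u i w) j = extend u j := by
  unfold extend
  split_ifs with hj
  · rw [Function.update_of_ne]
    rintro rfl
    exact h rfl
  · rfl

theorem extend_update_self [NeZero n] {T : ℕ} (u : Fin T → Fin n) (i : Fin T) (w : Fin n) :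
    extend (Function.update u i w) i = w := by
  simp [extend]

/-- The deviation is a martingale with increments of absolute value at most `1`, so its second
moment grows by at most `1` in each step. -/
theorem expect_deviation_sq_le [NeZero n] [NeZero q] (I : Instance n q) (x : Fin n → Fin q)
    (t₀ T t : ℕ) (ht : t ≤ T) (v : Fin n) (a : Fin q) :
    Finset.expect Finset.univ (fun u : Fin T → Fin n =>
      I.deviation x t₀ (extend u) t v a ^ 2) ≤ t := by
  have hn : (0 : ℝ) < n := by exact_mod_cast Nat.pos_of_ne_zero (NeZero.ne n)
  induction t with
  | zero => simp [deviation, conflicts]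
  | succ t ih =>
    have ih' := ih (by omega)
    rw [← expect_expect_update (⟨t, by omega⟩ : Fin T)]
    have step : ∀ u : Fin T → Fin n, Finset.expect Finset.univ (fun w : Fin n =>
        I.deviation x t₀ (extend (Function.update u ⟨t, by omega⟩ w)) (t + 1) v a ^ 2) ≤
          I.deviation x t₀ (extend u) t v a ^ 2 + 1 := by
      intro u
      have hbelow : ∀ w, ∀ j < t, extend (Function.update u ⟨t, by omega⟩ w) j = extend u j :=
        fun w j hj => extend_update_of_ne u ⟨t, by omega⟩ w hj.ne
      have hself : ∀ w, extend (Function.update u ⟨t, by omega⟩ w) t = w := fun w =>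
        extend_update_self u ⟨t, by omega⟩ w
      simp only [deviation_succ, I.deviation_congr x t₀ (hbelow _), hself,
        I.policy_congr x t₀ (hbelow _)]
      set M := I.deviation x t₀ (extend u) t v a
      set f : Fin n → ℝ := fun w => I.viol v a w (I.policy x t₀ (extend u) t w)
      set A := (∑ w, f w) / n with hA
      have hA' : Finset.expect Finset.univ f = A := by
        rw [Fintype.expect_eq_sum_div_card, Fintype.card_fin]
      have hf0 : ∀ w, 0 ≤ f w := fun w => Nat.cast_nonneg _
      have hf1 : ∀ w, f w ≤ 1 := fun w => Nat.cast_le_one.2 (I.viol_le_one _ _ _ _)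
      have hA0 : 0 ≤ A := by rw [← hA']; exact Finset.expect_nonneg fun w _ => hf0 w
      have hA1 : A ≤ 1 := by
        rw [← hA']
        exact Finset.expect_le Finset.univ_nonempty fun w _ => hf1 w
      calc Finset.expect Finset.univ (fun w => (M + (f w - A)) ^ 2)
          ≤ Finset.expect Finset.univ (fun w => (M ^ 2 + 1 - 2 * M * A) + 2 * M * f w) := by
            refine Finset.expect_le_expect fun w _ => ?_
            nlinarith [hf0 w, hf1 w]
        _ = M ^ 2 + 1 := by
            rw [Finset.expect_add_distrib, ← Finset.mul_expect, hA', Fintype.expect_const]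
            ring
    calc _ ≤ Finset.expect Finset.univ (fun u : Fin T → Fin n =>
          I.deviation x t₀ (extend u) t v a ^ 2 + 1) := Finset.expect_le_expect fun u _ => step u
      _ ≤ ((t + 1 : ℕ) : ℝ) := by
        rw [Finset.expect_add_distrib, Fintype.expect_const]
        push_cast
        linarith

theorem expect_abs_deviation_le [NeZero n] [NeZero q] (I : Instance n q) (x : Fin n → Fin q)
    (t₀ T t : ℕ) (ht0 : 1 ≤ t) (ht : t ≤ T) (v : Fin n) (a : Fin q) :
    Finset.expect Finset.univ (fun u : Fin T → Fin n =>
      |I.deviation x t₀ (extend u) t v a|) ≤ √t := by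
  have hpos : 0 < √(t : ℝ) := Real.sqrt_pos.2 (by exact_mod_cast ht0)
  have hsq : √(t : ℝ) ^ 2 = t := Real.sq_sqrt (by positivity)
  calc _ ≤ Finset.expect Finset.univ (fun u : Fin T → Fin n =>
        (1 / (2 * √t)) * I.deviation x t₀ (extend u) t v a ^ 2 + √t / 2) := by
        refine Finset.expect_le_expect fun u _ => ?_
        have := sq_nonneg (|I.deviation x t₀ (extend u) t v a| - √t)
        rw [sub_sq, sq_abs] at this
        rw [div_mul_eq_mul_div, one_mul, div_add_div _ _ (by positivity) (by norm_num),
          le_div_iff₀ (by positivity)]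
        nlinarith
    _ ≤ (1 / (2 * √t)) * t + √t / 2 := by
        rw [Finset.expect_add_distrib, Fintype.expect_const, ← Finset.mul_expect]
        gcongr
        exact I.expect_deviation_sq_le x t₀ T t ht v a
    _ = √t := by
        nth_rewrite 2 [← hsq]
        field_simp
        ring

/-- The cost of the average of the first `t` policies, times `t ^ 2`. -/
def energy [NeZero q] (I : Instance n q) (x : Fin n → Fin q) (t₀ : ℕ) (U : ℕ → Fin n) (t : ℕ) :
    ℕ :=
  ∑ i ∈ Finset.range t, ∑ j ∈ Finset.range t,
    I.pairCost (I.policy x t₀ U i) (I.policy x t₀ U j)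

/-- A greedy policy is, up to the deviations, at least as good against the average of the previous
policies as this average is against itself. -/
theorem energy_succ_le [NeZero n] [NeZero q] (I : Instance n q) (x : Fin n → Fin q) (t₀ : ℕ)
    (U : ℕ → Fin n) (t : ℕ) (ht : t₀ ≤ t) :
    (t : ℝ) * I.energy x t₀ U (t + 1) ≤ (t + 2) * I.energy x t₀ U t +
      4 * n * t * (∑ v, ∑ a, |I.deviation x t₀ U t v a|) + t * (n : ℝ) ^ 2 := by
  have hn : (0 : ℝ) < n := by exact_mod_cast Nat.pos_of_ne_zero (NeZero.ne n)
  set P := I.policy x t₀ U with hP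
  set C := I.conflicts U (I.sampleLabels (x ∘ U) t₀ U t) t with hC
  set M := I.deviation x t₀ U t with hM
  set A : Fin n → Fin q → ℝ := fun v a =>
    ∑ j ∈ Finset.range t, ∑ w, (I.viol v a w (P j w) : ℝ) with hA
  have hAC : ∀ v a, A v a = n * (C v a - M v a) := by
    intro v a
    have : M v a = C v a - A v a / n := rfl
    rw [this]
    field_simp
    ring
  have hAsum : ∀ p : Fin n → Fin q,
      ∑ v, A v (p v) = ∑ j ∈ Finset.range t, (I.pairCost p (P j) : ℝ) := by
    intro p
    rw [hA, Finset.sum_comm]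
    simp [pairCost]
  set Q : ℝ := ∑ j ∈ Finset.range t, (I.pairCost (P t) (P j) : ℝ) with hQ
  have hF : (I.energy x t₀ U t : ℝ) = ∑ i ∈ Finset.range t, ∑ v, A v (P i v) := by
    simp_rw [hAsum]
    simp [energy, hP]
  have hF' : (I.energy x t₀ U (t + 1) : ℝ) =
      I.energy x t₀ U t + 2 * Q + I.pairCost (P t) (P t) := by
    have h1 : ∑ i ∈ Finset.range t, (I.pairCost (P i) (P t) : ℝ) = Q :=
      Finset.sum_congr rfl fun i _ => by rw [pairCost_comm]
    unfold energy
    simp only [Finset.sum_range_succ, Finset.sum_add_distrib]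
    push_cast
    rw [← hP, h1, ← hQ]
    ring
  have hgreedy : ∀ v a, C v (P t v) ≤ C v a := by
    intro v a
    have : P t v = firstMin (C v) := by
      rw [hP, policy, if_neg (not_lt.2 ht)]
      rfl
    rw [this]
    exact firstMin_le _ _
  have hpt : ∀ v i, A v (P t v) ≤ A v (P i v) + 2 * n * ∑ a, |M v a| := by
    intro v i
    have h1 : (C v (P t v) : ℝ) ≤ C v (P i v) := by exact_mod_cast hgreedy v _
    have h2 : ∀ a, |M v a| ≤ ∑ a, |M v a| := fun a =>
      Finset.single_le_sum (f := fun a => |M v a|) (fun a _ => abs_nonneg _) (Finset.mem_univ a)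
    have h3 := (neg_abs_le (M v (P t v))).trans' (neg_le_neg (h2 (P t v)))
    have h4 := (le_abs_self (M v (P i v))).trans (h2 (P i v))
    rw [hAC, hAC]
    nlinarith
  have htQ : t * Q ≤ I.energy x t₀ U t + 2 * n * t * ∑ v, ∑ a, |M v a| := by
    calc t * Q = ∑ _i ∈ Finset.range t, ∑ v, A v (P t v) := by
          rw [Finset.sum_const, Finset.card_range, nsmul_eq_mul, hAsum]
      _ ≤ ∑ i ∈ Finset.range t, ∑ v, (A v (P i v) + 2 * n * ∑ a, |M v a|) :=
          Finset.sum_le_sum fun i _ => Finset.sum_le_sum fun v _ => hpt v i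
      _ = _ := by
          simp only [Finset.sum_add_distrib, ← Finset.mul_sum, Finset.sum_const,
            Finset.card_range, nsmul_eq_mul]
          rw [hF]
          ring
  have hPP : (I.pairCost (P t) (P t) : ℝ) ≤ (n : ℝ) ^ 2 := by exact_mod_cast I.pairCost_le _ _
  rw [hF']
  have ht0 : (0 : ℝ) ≤ t := Nat.cast_nonneg t
  nlinarith [mul_le_mul_of_nonneg_left hPP ht0]

/-- The error of one step of `expect_energy_le` is bounded by a telescoping difference. -/
theorem sqrt_div_succ_sq_le (t : ℝ) (ht : 1 ≤ t) :
    √t / (t + 1) ^ 2 ≤ 2 * (1 / √t - 1 / √(t + 1)) := by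
  have ha : 0 < √t := Real.sqrt_pos.2 (by linarith)
  have hb : 0 < √(t + 1) := Real.sqrt_pos.2 (by linarith)
  have hab : √t ≤ √(t + 1) := Real.sqrt_le_sqrt (by linarith)
  have ha2 : √t ^ 2 = t := Real.sq_sqrt (by linarith)
  have hb2 : √(t + 1) ^ 2 = t + 1 := Real.sq_sqrt (by linarith)
  set a := √t
  set b := √(t + 1)
  have h1 : 1 / a - 1 / b = 1 / (a * b * (a + b)) := by
    have : (b - a) * (a + b) = 1 := by nlinarith
    field_simp
    nlinarith
  rw [h1, ← hb2, mul_one_div, div_le_div_iff₀ (by positivity) (by positivity)]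
  have h2 : a * a * (a + b) ≤ b * b * (b + b) := by gcongr
  nlinarith

/-- The first `t₀` policies are `x`, and the average cost of the policies grows slowly afterwards:
by `energy_succ_le` the energy divided by `t ^ 2` increases by `O(q * n ^ 2 * √t / t ^ 2)` in
expectation. -/
theorem expect_energy_le [NeZero n] [NeZero q] (I : Instance n q) (x : Fin n → Fin q)
    (t₀ T t : ℕ) (ht₀ : 1 ≤ t₀) (ht₀t : t₀ ≤ t) (htT : t ≤ T) :
    Finset.expect Finset.univ (fun u : Fin T → Fin n => (I.energy x t₀ (extend u) t : ℝ)) ≤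
      (t : ℝ) ^ 2 * (I.cost x + 10 * q * (n : ℝ) ^ 2 * (1 / √t₀ - 1 / √t)) := by
  induction t, ht₀t using Nat.le_induction with
  | base =>
    have : ∀ u : Fin T → Fin n, (I.energy x t₀ (extend u) t₀ : ℝ) = (t₀ : ℝ) ^ 2 * I.cost x := by
      intro u
      have h : I.energy x t₀ (extend u) t₀ =
          ∑ _i ∈ Finset.range t₀, ∑ _j ∈ Finset.range t₀, I.cost x := by
        refine Finset.sum_congr rfl fun i hi => Finset.sum_congr rfl fun j hj => ?_
        have e : ∀ i ∈ Finset.range t₀, I.policy x t₀ (extend u) i = x := fun i hi => by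
          funext v
          rw [policy, if_pos (Finset.mem_range.1 hi)]
        rw [e i hi, e j hj, cost]
      rw [h]
      simp
      ring
    simp [this]
  | succ t ht ih =>
    have ih' := ih (by omega)
    set φ := Finset.expect Finset.univ (fun u : Fin T → Fin n => (I.energy x t₀ (extend u) t : ℝ))
    set φ' := Finset.expect Finset.univ
      (fun u : Fin T → Fin n => (I.energy x t₀ (extend u) (t + 1) : ℝ))
    have ht1 : (1 : ℝ) ≤ t := by exact_mod_cast ht₀.trans ht
    have hq1 : (1 : ℝ) ≤ q := by exact_mod_cast Nat.pos_of_ne_zero (NeZero.ne q)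
    have hs1 : 1 ≤ √(t : ℝ) := Real.one_le_sqrt.2 ht1
    have hdev : Finset.expect Finset.univ (fun u : Fin T → Fin n =>
        ∑ v, ∑ a, |I.deviation x t₀ (extend u) t v a|) ≤ n * q * √t := by
      rw [Finset.expect_sum_comm]
      simp_rw [Finset.expect_sum_comm]
      calc _ ≤ ∑ _v : Fin n, ∑ _a : Fin q, √(t : ℝ) :=
            Finset.sum_le_sum fun v _ => Finset.sum_le_sum fun a _ =>
              I.expect_abs_deviation_le x t₀ T t (by omega) (by omega) v a
        _ = _ := by simp; ring
    have hstep : t * φ' ≤ (t + 2) * φ + 4 * n * t * (n * q * √t) + t * (n : ℝ) ^ 2 := by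
      calc t * φ' = Finset.expect Finset.univ (fun u : Fin T → Fin n =>
            (t : ℝ) * I.energy x t₀ (extend u) (t + 1)) := Finset.mul_expect _ _ _
        _ ≤ Finset.expect Finset.univ (fun u : Fin T → Fin n =>
            ((t : ℝ) + 2) * I.energy x t₀ (extend u) t +
            4 * n * t * (∑ v, ∑ a, |I.deviation x t₀ (extend u) t v a|) + t * (n : ℝ) ^ 2) :=
            Finset.expect_le_expect fun u _ => I.energy_succ_le x t₀ (extend u) t ht
        _ ≤ _ := by
            rw [Finset.expect_add_distrib, Finset.expect_add_distrib, Fintype.expect_const,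
              ← Finset.mul_expect, ← Finset.mul_expect]
            gcongr
    have hstep2 : t * φ' ≤ (t + 2) * φ + t * (5 * q * (n : ℝ) ^ 2 * √t) := by
      have : (n : ℝ) ^ 2 ≤ q * (n : ℝ) ^ 2 * √t := by
        have := mul_le_mul hq1 hs1 (by norm_num) (by linarith)
        nlinarith [sq_nonneg (n : ℝ)]
      nlinarith
    have hkey := sqrt_div_succ_sq_le t ht1
    rw [div_le_iff₀ (by positivity)] at hkey
    push_cast
    set V : ℝ := (I.cost x : ℝ)
    set E : ℝ := q * (n : ℝ) ^ 2
    have hE : 0 ≤ E := by positivity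
    set α := 1 / √(t₀ : ℝ)
    set β := 1 / √(t : ℝ)
    set γ := 1 / √((t : ℝ) + 1)
    have hVn : 0 ≤ V + 10 * q * (n : ℝ) ^ 2 * (α - β) := by
      have : β ≤ α := by
        apply one_div_le_one_div_of_le
        · exact Real.sqrt_pos.2 (by exact_mod_cast ht₀)
        · exact Real.sqrt_le_sqrt (by exact_mod_cast ht)
      have : 0 ≤ V := Nat.cast_nonneg _
      have : 0 ≤ α - β := by linarith
      positivity
    have h1 : t * φ' ≤ t * ((t + 1) ^ 2 * (V + 10 * q * (n : ℝ) ^ 2 * (α - γ))) := by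
      calc t * φ' ≤ (t + 2) * φ + t * (5 * q * (n : ℝ) ^ 2 * √t) := hstep2
        _ ≤ (t + 2) * ((t : ℝ) ^ 2 * (V + 10 * q * (n : ℝ) ^ 2 * (α - β))) +
            t * (5 * E * (2 * (β - γ) * (t + 1) ^ 2)) := by
          have : 5 * q * (n : ℝ) ^ 2 * √t = 5 * E * √t := by ring
          rw [this]
          gcongr
        _ = t * ((t ^ 2 + 2 * t) * (V + 10 * q * (n : ℝ) ^ 2 * (α - β))) +
            t * ((t + 1) ^ 2 * (10 * E * (β - γ))) := by ring
        _ ≤ t * ((t + 1) ^ 2 * (V + 10 * q * (n : ℝ) ^ 2 * (α - β))) +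
            t * ((t + 1) ^ 2 * (10 * E * (β - γ))) := by
          gcongr
          nlinarith
        _ = _ := by ring
    exact le_of_mul_le_mul_left h1 (by linarith)

/-- Labelling each vertex by an independent uniformly random member of a family of assignments
costs, in expectation, at most the average over all pairs of members. -/
theorem expect_cost_rounding_le (I : Instance n q) {T : ℕ} [NeZero T]
    (g : Fin T → Fin n → Fin q) :
    Finset.expect Finset.univ (fun r : Fin n → Fin T => (I.cost fun v => g (r v) v : ℝ)) ≤
      (∑ i, ∑ j, (I.pairCost (g i) (g j) : ℝ)) / (T : ℝ) ^ 2 := by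
  have hpair : ∀ v w, Finset.expect Finset.univ (fun r : Fin n → Fin T =>
      (I.viol v (g (r v) v) w (g (r w) w) : ℝ)) ≤
        (∑ i, ∑ j, (I.viol v (g i v) w (g j w) : ℝ)) / (T : ℝ) ^ 2 := by
    intro v w
    by_cases h : v = w
    · subst h
      simp [viol_self]
    · rw [expect_two_coordinates h (fun i j => (I.viol v (g i v) w (g j w) : ℝ))]
      simp only [Fintype.expect_eq_sum_div_card, Fintype.card_fin]
      rw [← Finset.sum_div, div_div, sq]
  calc _ = ∑ v, ∑ w, Finset.expect Finset.univ (fun r : Fin n → Fin T =>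
        (I.viol v (g (r v) v) w (g (r w) w) : ℝ)) := by
        simp only [cost, pairCost, Nat.cast_sum]
        rw [Finset.expect_sum_comm]
        simp_rw [Finset.expect_sum_comm]
    _ ≤ ∑ v, ∑ w, (∑ i, ∑ j, (I.viol v (g i v) w (g j w) : ℝ)) / (T : ℝ) ^ 2 :=
        Finset.sum_le_sum fun v _ => Finset.sum_le_sum fun w _ => hpair v w
    _ = _ := by
        simp only [← Finset.sum_div, pairCost, Nat.cast_sum]
        congr 1
        rw [Finset.sum_congr rfl fun v _ => Finset.sum_comm, Finset.sum_comm]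
        refine Finset.sum_congr rfl fun i _ => ?_
        rw [Finset.sum_congr rfl fun v _ => Finset.sum_comm, Finset.sum_comm]

/-- The expected cost of the sampled assignment whose guess agrees with `x`. -/
theorem expect_cost_sampleReply_le [NeZero n] [NeZero q] (I : Instance n q) (x : Fin n → Fin q)
    (t₀ T : ℕ) (ht₀ : 1 ≤ t₀) (hT : t₀ ≤ T) :
    Finset.expect Finset.univ (fun u : Fin T → Fin n => Finset.expect Finset.univ
      fun r : Fin n → Fin T => (I.cost (I.sampleReply (x ∘ extend u) t₀ T (extend u)
        fun v => r v) : ℝ)) ≤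
      I.cost x + (n : ℝ) ^ 2 * (10 * q / √t₀ + 2 * t₀ / T) := by
  have : NeZero T := ⟨by omega⟩
  have hTpos : (0 : ℝ) < T := by exact_mod_cast ht₀.trans hT
  have hmain : ∀ u : Fin T → Fin n, Finset.expect Finset.univ
      (fun r : Fin n → Fin T => (I.cost (I.sampleReply (x ∘ extend u) t₀ T (extend u)
        fun v => r v) : ℝ)) ≤
      (I.energy x t₀ (extend u) T + 2 * t₀ * T * (n : ℝ) ^ 2) / (T : ℝ) ^ 2 := by
    intro u
    set g : ℕ → Fin n → Fin q := fun i =>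
      I.reply (extend u) (I.sampleLabels (x ∘ extend u) t₀ (extend u) T) i with hg
    have hgP : ∀ i < T, t₀ ≤ i → g i = I.policy x t₀ (extend u) i := by
      intro i hi h
      funext v
      rw [policy, if_neg (not_lt.2 h), hg]
      exact congrFun (I.reply_congr (fun _ _ => rfl) fun j hj =>
        I.sampleLabels_of_lt _ _ _ hj hi.le) v
    refine (I.expect_cost_rounding_le (fun i : Fin T => g i)).trans ?_
    gcongr
    have h1 : ∀ i ∈ Finset.range T, ∀ j ∈ Finset.range T, (I.pairCost (g i) (g j) : ℝ) ≤
        I.pairCost (I.policy x t₀ (extend u) i) (I.policy x t₀ (extend u) j) +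
          ((if i < t₀ then (n : ℝ) ^ 2 else 0) + if j < t₀ then (n : ℝ) ^ 2 else 0) := by
      intro i hi j hj
      have hle : (I.pairCost (g i) (g j) : ℝ) ≤ (n : ℝ) ^ 2 := by
        exact_mod_cast I.pairCost_le _ _
      have h0 : (0 : ℝ) ≤ I.pairCost (I.policy x t₀ (extend u) i)
        (I.policy x t₀ (extend u) j) := Nat.cast_nonneg _
      by_cases hi' : i < t₀
      · simp only [hi', if_true]
        split_ifs <;> linarith [sq_nonneg (n : ℝ)]
      · by_cases hj' : j < t₀
        · simp only [hi', hj', if_true, if_false]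
          linarith
        · rw [hgP i (Finset.mem_range.1 hi) (not_lt.1 hi'),
            hgP j (Finset.mem_range.1 hj) (not_lt.1 hj')]
          simp [hi', hj']
    have hcount : ∑ i ∈ Finset.range T, (if i < t₀ then (n : ℝ) ^ 2 else 0) =
        t₀ * (n : ℝ) ^ 2 := by
      rw [← Finset.sum_filter]
      have : Finset.filter (fun i => i < t₀) (Finset.range T) = Finset.range t₀ := by
        ext i
        simp only [Finset.mem_filter, Finset.mem_range]
        omega
      simp [this]
    calc ∑ i : Fin T, ∑ j : Fin T, (I.pairCost (g i) (g j) : ℝ)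
        = ∑ i ∈ Finset.range T, ∑ j ∈ Finset.range T, (I.pairCost (g i) (g j) : ℝ) := by
          rw [Finset.sum_range]
          refine Finset.sum_congr rfl fun i _ => ?_
          rw [Finset.sum_range]
      _ ≤ _ := Finset.sum_le_sum fun i hi => Finset.sum_le_sum fun j hj => h1 i hi j hj
      _ = _ := by
          simp only [Finset.sum_add_distrib, Finset.sum_const, Finset.card_range, nsmul_eq_mul,
            ← Finset.mul_sum, hcount]
          simp only [energy, Nat.cast_sum]
          ring
  refine (Finset.expect_le_expect fun u _ => hmain u).trans ?_
  rw [← Finset.expect_div, Finset.expect_add_distrib, Fintype.expect_const,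
    div_le_iff₀ (by positivity)]
  have h := I.expect_energy_le x t₀ T T ht₀ hT le_rfl
  have hγ : 0 ≤ 1 / √(T : ℝ) := by positivity
  have h2 : (T : ℝ) ^ 2 * (10 * q * (n : ℝ) ^ 2 * (1 / √t₀ - 1 / √T)) ≤
      (T : ℝ) ^ 2 * (10 * q * (n : ℝ) ^ 2 * (1 / √t₀)) := by
    gcongr
    linarith
  have h3 : (I.cost x + (n : ℝ) ^ 2 * (10 * q / √t₀ + 2 * t₀ / T)) * (T : ℝ) ^ 2 =
      (T : ℝ) ^ 2 * I.cost x + (T : ℝ) ^ 2 * (10 * q * (n : ℝ) ^ 2 * (1 / √t₀)) +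
        2 * t₀ * T * (n : ℝ) ^ 2 := by
    field_simp
    ring
  rw [h3]
  linarith

/-! ### The better of the two kinds of candidates -/

/-- With probability at least `2 / 3` over the sample `ω.1` and the rounding `ω.2`, the best of the
candidates is within a factor `1 + 1 / k` of the optimum. -/
theorem exists_good_samples [NeZero n] [NeZero q] (I : Instance n q) (x : Fin n → Fin q)
    (hx : ∀ y, I.cost x ≤ I.cost y) (k s : ℕ) (hk : 1 ≤ k) (hs : s = 6000 * q * k ^ 2) :
    ∃ S : Finset ((Fin (s ^ 3) → Fin n) × (Fin n → Fin (s ^ 3))),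
      2 * Fintype.card ((Fin (s ^ 3) → Fin n) × (Fin n → Fin (s ^ 3))) ≤ 3 * S.card ∧
      ∀ ω ∈ S, ∀ c, (∀ u a, c ≤ I.cost (I.pivotReply u a)) →
        (∀ d, c ≤ I.cost (I.sampleReply d (s ^ 2) (s ^ 3) (extend ω.1) fun v => ω.2 v)) →
        k * c ≤ (k + 1) * I.cost x := by
  have hn : 1 ≤ n := Nat.pos_of_ne_zero (NeZero.ne n)
  have hq : 1 ≤ q := Nat.pos_of_ne_zero (NeZero.ne q)
  have hs1 : 1 ≤ s := by
    rw [hs]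
    exact Nat.mul_pos (by omega) (by positivity)
  have : NeZero (s ^ 3) := ⟨by positivity⟩
  by_cases hcase : 40 * k * I.cost x ≤ (n - 1) ^ 2
  · refine ⟨Finset.univ, by rw [Finset.card_univ]; omega, fun ω _ c hc _ => ?_⟩
    obtain ⟨u, a, h⟩ := I.exists_pivotReply_cost_le hn x k hk hcase
    exact (Nat.mul_le_mul_left k (hc u a)).trans h
  · set V : ℝ := (I.cost x : ℝ) with hV
    set f : (Fin (s ^ 3) → Fin n) × (Fin n → Fin (s ^ 3)) → ℝ := fun ω =>
      I.cost (I.sampleReply (x ∘ extend ω.1) (s ^ 2) (s ^ 3) (extend ω.1) fun v => ω.2 v) - V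
    have hn2 : 2 ≤ n := by
      by_contra h
      have h1 : n = 1 := by omega
      subst h1
      have : I.cost x = 0 := by simp [cost, pairCost, viol_self]
      simp [this] at hcase
    have hqR : (1 : ℝ) ≤ q := by exact_mod_cast hq
    have hkR : (1 : ℝ) ≤ k := by exact_mod_cast hk
    have hsR : (1 : ℝ) ≤ s := by exact_mod_cast hs1
    have hnR : (2 : ℝ) ≤ n := by exact_mod_cast hn2
    set ε : ℝ := 12 * q * (n : ℝ) ^ 2 / s with hε
    have hεpos : 0 < ε := by positivity
    have hE : Finset.expect Finset.univ f ≤ ε := by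
      rw [← Finset.univ_product_univ, Finset.expect_product]
      simp only [Finset.expect_sub_distrib, Fintype.expect_const]
      have h := I.expect_cost_sampleReply_le x (s ^ 2) (s ^ 3) (Nat.one_le_pow _ _ hs1)
        (Nat.pow_le_pow_right hs1 (by norm_num))
      push_cast at h
      rw [Real.sqrt_sq (by linarith)] at h
      have h2 : (10 * q / s + 2 * (s : ℝ) ^ 2 / s ^ 3) ≤ 12 * q / s := by
        have : 2 * (s : ℝ) ^ 2 / s ^ 3 = 2 / s := by field_simp
        rw [this, ← add_div]
        gcongr
        linarith
      have h3 : (n : ℝ) ^ 2 * (10 * q / s + 2 * (s : ℝ) ^ 2 / s ^ 3) ≤ ε := by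
        calc _ ≤ (n : ℝ) ^ 2 * (12 * q / s) := by gcongr
          _ = ε := by rw [hε]; ring
      linarith
    have hf0 : ∀ ω, 0 ≤ f ω := fun ω => sub_nonneg.2 (by rw [hV]; exact_mod_cast hx _)
    have hM := card_lt_mul_le_of_expect_le f hεpos hf0 hE
    refine ⟨Finset.univ.filter fun ω => ¬ 3 * ε < f ω, ?_, ?_⟩
    · have h1 := Finset.card_filter_add_card_filter_not (s := Finset.univ)
        (fun ω => 3 * ε < f ω)
      rw [Finset.card_univ] at h1
      have h2 : 3 * (Finset.univ.filter fun ω => 3 * ε < f ω).card ≤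
        Fintype.card ((Fin (s ^ 3) → Fin n) × (Fin n → Fin (s ^ 3))) := by exact_mod_cast hM
      omega
    · intro ω hω c _ hc
      have h1 : f ω ≤ 3 * ε := not_lt.1 (Finset.mem_filter.1 hω).2
      have h2 : (c : ℝ) ≤ V + 3 * ε := by
        have : (c : ℝ) ≤ I.cost (I.sampleReply (x ∘ extend ω.1) (s ^ 2) (s ^ 3) (extend ω.1)
          fun v => ω.2 v) := by exact_mod_cast hc _
        linarith
      -- the optimum is so large that the additive error is a fraction of it
      have h3 : (n : ℝ) ^ 2 ≤ 160 * k * V := by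
        push Not at hcase
        have h4 : ((n - 1 : ℕ) : ℝ) ^ 2 < 40 * k * V := by rw [hV]; exact_mod_cast hcase
        rw [Nat.cast_sub hn] at h4
        push_cast at h4
        nlinarith
      have h5 : k * (3 * ε) ≤ V := by
        have : k * (3 * ε) = 36 * q * k * (n : ℝ) ^ 2 / s := by rw [hε]; ring
        rw [this, div_le_iff₀ (by linarith), hs]
        push_cast
        have h6 : 36 * q * k * (n : ℝ) ^ 2 ≤ 36 * q * k * (160 * k * V) := by gcongr
        have h7 : 0 ≤ V * (q * (k : ℝ) ^ 2) := by positivity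
        nlinarith
      have h8 : (k : ℝ) * c ≤ (k + 1) * V := by
        have := mul_le_mul_of_nonneg_left h2 (by linarith : (0 : ℝ) ≤ k)
        nlinarith
      rw [hV] at h8
      exact_mod_cast h8

end Instance

/-! ### Reasoning about deterministic programs -/

/-- Running the command `c` from the memory `s` takes `t` steps and leads to the memory `s'`.
There is no rule for `rand`. -/
inductive Exec (b : ℕ) : Cmd → Store → ℕ → Store → Prop
  | skip (s) : Exec b .skip s 1 s
  | const (x c s) : Exec b (.const x c) s 1 (s.setReg x (c % 2 ^ b))
  | move (x y s) : Exec b (.move x y) s 1 (s.setReg x (s.reg y))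
  | op (f x y z s) : Exec b (.op f x y z) s 1 (s.setReg x (f.eval b (s.reg y) (s.reg z)))
  | load (x a y s) : Exec b (.load x a y) s 1 (s.setReg x (s.arr a (s.reg y)))
  | write (a y x s) : Exec b (.write a y x) s 1 (s.setArr a (s.reg y) (s.reg x))
  | seq {c d s s' s'' t t'} : Exec b c s t s' → Exec b d s' t' s'' →
      Exec b (.seq c d) s (t + t' + 1) s''
  | cond_pos {x c d s s' t} : s.reg x ≠ 0 → Exec b c s t s' → Exec b (.cond x c d) s (t + 1) s'
  | cond_zero {x c d s s' t} : s.reg x = 0 → Exec b d s t s' → Exec b (.cond x c d) s (t + 1) s'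
  | loop_pos {x c s s' s'' t t'} : s.reg x ≠ 0 → Exec b c s t s' → Exec b (.loop x c) s' t' s'' →
      Exec b (.loop x c) s (t + t' + 1) s''
  | loop_zero {x c s} : s.reg x = 0 → Exec b (.loop x c) s 1 s

theorem run_succ_of_step {b : ℕ} {C C' : Config} (h : step b C = PMF.pure C') (r : ℕ) :
    run b (r + 1) C = run b r C' := by
  rw [run, h, PMF.pure_bind]

theorem Exec.run_eq {b : ℕ} {c : Cmd} {s s' : Store} {t : ℕ} (h : Exec b c s t s')
    (K : List Cmd) (r : ℕ) : run b (r + t) (c :: K, s) = run b r (K, s') := by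
  induction h generalizing K r with
  | skip | const | move | op | load | write => exact run_succ_of_step (by rw [step]) _
  | @seq c d s s' s'' t t' _ _ ih1 ih2 =>
    rw [show r + (t + t' + 1) = ((r + t') + t) + 1 by ring, run_succ_of_step (by rw [step]),
      ih1, ih2]
  | @cond_pos x c d s s' t hx _ ih =>
    rw [← add_assoc, run_succ_of_step (by rw [step, if_pos hx]), ih]
  | @cond_zero x c d s s' t hx _ ih =>
    rw [← add_assoc, run_succ_of_step (by rw [step, if_neg (not_not.2 hx)]), ih]
  | @loop_pos x c s s' s'' t t' hx _ _ ih1 ih2 =>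
    rw [show r + (t + t' + 1) = ((r + t') + t) + 1 by ring,
      run_succ_of_step (by rw [step, if_pos hx]), ih1, ih2]
  | @loop_zero x c s hx => exact run_succ_of_step (by rw [step, if_neg (not_not.2 hx)]) _

theorem run_nil (b r : ℕ) (s : Store) : run b r ([], s) = PMF.pure ([], s) := by
  induction r with
  | zero => rfl
  | succ r ih => rw [run_succ_of_step (by rw [step]), ih]

/-- Whether the command `c` mentions register `x` as a target. -/
def Cmd.writesReg : Cmd → ℕ → Bool
  | .const x _, y | .move x _, y | .op _ x _ _, y | .load x _ _, y | .rand x _, y => x == y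
  | .skip, _ | .write _ _ _, _ => false
  | .seq c d, y | .cond _ c d, y => c.writesReg y || d.writesReg y
  | .loop _ c, y => c.writesReg y

/-- Whether the command `c` mentions array `a` as a target. -/
def Cmd.writesArr : Cmd → ℕ → Bool
  | .write a _ _, y => a == y
  | .skip, _ | .const _ _, _ | .move _ _, _ | .op _ _ _ _, _ | .load _ _ _, _ | .rand _ _, _ =>
    false
  | .seq c d, y | .cond _ c d, y => c.writesArr y || d.writesArr y
  | .loop _ c, y => c.writesArr y

/-- The memories `s` and `s'` agree except for the registers and arrays to which `c` writes. -/
structure Frame (c : Cmd) (s s' : Store) : Prop where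
  reg : ∀ x, c.writesReg x = false → s'.reg x = s.reg x
  arr : ∀ a, c.writesArr a = false → s'.arr a = s.arr a

theorem Frame.refl (c : Cmd) (s : Store) : Frame c s s := ⟨fun _ _ => rfl, fun _ _ => rfl⟩

theorem Frame.trans {c : Cmd} {s s' s'' : Store} (h : Frame c s s') (h' : Frame c s' s'') :
    Frame c s s'' :=
  ⟨fun x hx => (h'.reg x hx).trans (h.reg x hx), fun a ha => (h'.arr a ha).trans (h.arr a ha)⟩

theorem Frame.mono {c d : Cmd} {s s' : Store} (h : Frame c s s')
    (hr : ∀ x, d.writesReg x = false → c.writesReg x = false)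
    (ha : ∀ a, d.writesArr a = false → c.writesArr a = false) : Frame d s s' :=
  ⟨fun x hx => h.reg x (hr x hx), fun a hx => h.arr a (ha a hx)⟩

theorem frame_setReg {c : Cmd} {x : ℕ} (h : c.writesReg x = true) (s : Store) (w : ℕ) :
    Frame c s (s.setReg x w) := by
  refine ⟨fun y hy => ?_, fun _ _ => rfl⟩
  simp only [Store.setReg]
  rw [Function.update_of_ne]
  rintro rfl
  simp [h] at hy

theorem Exec.frame {b : ℕ} {c : Cmd} {s s' : Store} {t : ℕ} (h : Exec b c s t s') :
    Frame c s s' := by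
  induction h with
  | skip | loop_zero => exact Frame.refl _ _
  | const | move | op | load => exact frame_setReg (by simp [Cmd.writesReg]) _ _
  | write a y x s =>
    refine ⟨fun _ _ => rfl, fun i hi => ?_⟩
    simp only [Store.setArr]
    rw [Function.update_of_ne]
    rintro rfl
    simp [Cmd.writesArr] at hi
  | seq _ _ ih1 ih2 =>
    refine Frame.trans (ih1.mono ?_ ?_) (ih2.mono ?_ ?_) <;>
      simp +contextual [Cmd.writesReg, Cmd.writesArr]
  | cond_pos _ _ ih | cond_zero _ _ ih =>
    refine ih.mono ?_ ?_ <;> simp +contextual [Cmd.writesReg, Cmd.writesArr]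
  | loop_pos _ _ _ ih1 ih2 => exact Frame.trans (ih1.mono (fun _ h => h) fun _ h => h) ih2

/-- From the memory `s`, the command `c` terminates within `N` steps in a memory with the
property `Q`. -/
def Within (b : ℕ) (c : Cmd) (s : Store) (N : ℕ) (Q : Store → Prop) : Prop :=
  ∃ t s', t ≤ N ∧ Exec b c s t s' ∧ Q s'

theorem Within.conseq {b : ℕ} {c : Cmd} {s : Store} {N L : ℕ} {Q R : Store → Prop}
    (h : Within b c s N Q) (hQ : ∀ s', Frame c s s' → Q s' → R s') (hN : N ≤ L) :
    Within b c s L R := by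
  obtain ⟨t, s', ht, he, hq⟩ := h
  exact ⟨t, s', ht.trans hN, he, hQ s' he.frame hq⟩

theorem Within.seq {b : ℕ} {c d : Cmd} {s : Store} {N M L : ℕ} {Q R : Store → Prop}
    (h : Within b c s N Q) (h' : ∀ s', Frame c s s' → Q s' → Within b d s' M R)
    (hL : N + M + 1 ≤ L) : Within b (.seq c d) s L R := by
  obtain ⟨t, s', ht, he, hq⟩ := h
  obtain ⟨t', s'', ht', he', hr⟩ := h' s' he.frame hq
  exact ⟨t + t' + 1, s'', by omega, he.seq he', hr⟩

theorem Within.cond {b x : ℕ} {c d : Cmd} {s : Store} {N L : ℕ} {R : Store → Prop}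
    (h : s.reg x ≠ 0 → Within b c s N R) (h' : s.reg x = 0 → Within b d s N R)
    (hL : N + 1 ≤ L) : Within b (.cond x c d) s L R := by
  by_cases hx : s.reg x = 0
  · obtain ⟨t, s', ht, he, hr⟩ := h' hx
    exact ⟨t + 1, s', by omega, .cond_zero hx he, hr⟩
  · obtain ⟨t, s', ht, he, hr⟩ := h hx
    exact ⟨t + 1, s', by omega, .cond_pos hx he, hr⟩

/-- Whether a command contains neither loops nor random choices. -/
def Cmd.straight : Cmd → Bool
  | .rand _ _ | .loop _ _ => false
  | .seq c d | .cond _ c d => c.straight && d.straight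
  | _ => true

/-- The most steps that a command without loops takes. -/
def Cmd.steps : Cmd → ℕ
  | .seq c d => c.steps + d.steps + 1
  | .cond _ c d => max c.steps d.steps + 1
  | _ => 1

/-- The effect of a command without loops and randomness. -/
def Cmd.effect (b : ℕ) : Cmd → Store → Store
  | .skip, s | .rand _ _, s | .loop _ _, s => s
  | .const x c, s => s.setReg x (c % 2 ^ b)
  | .move x y, s => s.setReg x (s.reg y)
  | .op f x y z, s => s.setReg x (f.eval b (s.reg y) (s.reg z))
  | .load x a y, s => s.setReg x (s.arr a (s.reg y))
  | .write a y x, s => s.setArr a (s.reg y) (s.reg x)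
  | .seq c d, s => d.effect b (c.effect b s)
  | .cond x c d, s => if s.reg x ≠ 0 then c.effect b s else d.effect b s

theorem within_effect (b : ℕ) {c : Cmd} (h : c.straight = true) (s : Store) :
    Within b c s c.steps (fun s' => s' = c.effect b s) := by
  induction c generalizing s with
  | skip => exact ⟨_, _, le_rfl, .skip s, rfl⟩
  | const x c => exact ⟨_, _, le_rfl, .const x c s, rfl⟩
  | move x y => exact ⟨_, _, le_rfl, .move x y s, rfl⟩
  | op f x y z => exact ⟨_, _, le_rfl, .op f x y z s, rfl⟩
  | load x a y => exact ⟨_, _, le_rfl, .load x a y s, rfl⟩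
  | write a y x => exact ⟨_, _, le_rfl, .write a y x s, rfl⟩
  | rand | loop => simp [Cmd.straight] at h
  | seq c d ih1 ih2 =>
    simp only [Cmd.straight, Bool.and_eq_true] at h
    refine (ih1 h.1 s).seq (fun s' _ hs' => ?_) le_rfl
    subst hs'
    exact ih2 h.2 _
  | cond x c d ih1 ih2 =>
    simp only [Cmd.straight, Bool.and_eq_true] at h
    refine Within.cond (N := max c.steps d.steps) (fun hx => ?_) (fun hx => ?_) le_rfl
    · refine (ih1 h.1 s).conseq (fun s' _ hs' => ?_) (le_max_left _ _)
      rw [hs', Cmd.effect, if_pos hx]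
    · refine (ih2 h.2 s).conseq (fun s' _ hs' => ?_) (le_max_right _ _)
      rw [hs', Cmd.effect, if_neg (not_not.2 hx)]

theorem within_straight {b : ℕ} {c : Cmd} {s : Store} {N : ℕ} {Q : Store → Prop}
    (h : c.straight = true) (hN : c.steps ≤ N) (hQ : Q (c.effect b s)) : Within b c s N Q :=
  (within_effect b h s).conseq (fun _ _ hs => hs ▸ hQ) hN

/-- A loop that runs exactly `N` times, with the invariant `J`. -/
theorem within_loop {b x N B : ℕ} {c : Cmd} {s : Store} (J : ℕ → Store → Prop) (h0 : J 0 s)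
    (hbody : ∀ j < N, ∀ s', Frame c s s' → J j s' →
      s'.reg x ≠ 0 ∧ Within b c s' B (J (j + 1)))
    (hend : ∀ s', J N s' → s'.reg x = 0) :
    Within b (.loop x c) s (N * (B + 1) + 1) (J N) := by
  have key : ∀ m ≤ N, ∀ s', Frame c s s' → J (N - m) s' →
      Within b (.loop x c) s' (m * (B + 1) + 1) (J N) := by
    intro m
    induction m with
    | zero => exact fun _ s' _ hJ => ⟨1, s', by omega, .loop_zero (hend s' hJ), hJ⟩
    | succ m ih =>
      intro hm s' hF hJ
      obtain ⟨hx, t, s'', ht, he, hJ'⟩ := hbody (N - (m + 1)) (by omega) s' hF hJ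
      rw [show N - (m + 1) + 1 = N - m by omega] at hJ'
      obtain ⟨t', s₃, ht', he', hJ''⟩ := ih (by omega) s'' (hF.trans he.frame) hJ'
      refine ⟨t + t' + 1, s₃, ?_, .loop_pos hx he he', hJ''⟩
      rw [Nat.succ_mul]
      omega
  exact key N le_rfl s (Frame.refl _ _) (by simpa using h0)

/-- The loop in which register `i` runs through the numbers below the content of register `m`.
Register `f` holds the loop condition, and register `3` has to hold the number `1`. -/
def forTo (i m f : ℕ) (c : Cmd) : Cmd :=
  .seq (.const i 0) (.seq (.op .lt f i m)
    (.loop f (.seq c (.seq (.op .add i i 3) (.op .lt f i m)))))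

theorem forTo_writesReg (i m f : ℕ) (c : Cmd) (x : ℕ) :
    (forTo i m f c).writesReg x = false ↔ c.writesReg x = false ∧ i ≠ x ∧ f ≠ x := by
  simp only [forTo, Cmd.writesReg, Bool.or_eq_false_iff, beq_eq_false_iff_ne]
  tauto

theorem forTo_writesArr (i m f : ℕ) (c : Cmd) (a : ℕ) :
    (forTo i m f c).writesArr a = c.writesArr a := by
  simp [forTo, Cmd.writesArr]

theorem within_forTo {b i m f N B L : ℕ} {c : Cmd} {s : Store} (J : ℕ → Store → Prop)
    (hm : s.reg m = N) (h3 : s.reg 3 = 1) (hN : N < 2 ^ b)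
    (hwr : (c.writesReg i || c.writesReg m || c.writesReg 3) = false)
    (hne : (i == m || i == 3 || f == i || f == m || f == 3) = false)
    (hins : ∀ j s w w', J j s → J j ((s.setReg i w).setReg f w'))
    (h0 : J 0 s)
    (hbody : ∀ j < N, ∀ s', Frame (forTo i m f c) s s' → s'.reg i = j → J j s' →
      Within b c s' B (J (j + 1)))
    (hL : N * (B + 5) + 5 ≤ L) :
    Within b (forTo i m f c) s L (J N) := by
  simp only [Bool.or_eq_false_iff, beq_eq_false_iff_ne] at hwr hne
  obtain ⟨⟨hci, hcm⟩, hc3⟩ := hwr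
  obtain ⟨⟨⟨⟨him, hi3⟩, hfi⟩, hfm⟩, hf3⟩ := hne
  set s₁ := (s.setReg i (0 % 2 ^ b)).setReg f
    (BinOp.eval b .lt ((s.setReg i (0 % 2 ^ b)).reg i) ((s.setReg i (0 % 2 ^ b)).reg m)) with hs₁
  set body : Cmd := .seq c (.seq (.op .add i i 3) (.op .lt f i m)) with hbodydef
  have hFr : ∀ s', Frame body s₁ s' → Frame (forTo i m f c) s s' := by
    intro s' hF
    constructor
    · intro x hx
      rw [forTo_writesReg] at hx
      rw [hF.reg x (by
        simp only [hbodydef, Cmd.writesReg, Bool.or_eq_false_iff, beq_eq_false_iff_ne]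
        tauto)]
      simp [hs₁, Store.setReg, Function.update_of_ne hx.2.1.symm,
        Function.update_of_ne hx.2.2.symm]
    · intro a ha
      rw [forTo_writesArr] at ha
      rw [hF.arr a (by simp [hbodydef, Cmd.writesArr, ha])]
      rfl
  have hm1 : s₁.reg m = N := by
    simp [hs₁, Store.setReg, Function.update_of_ne him.symm, Function.update_of_ne hfm.symm, hm]
  have h31 : s₁.reg 3 = 1 := by
    simp [hs₁, Store.setReg, Function.update_of_ne hi3.symm, Function.update_of_ne hf3.symm, h3]
  have hloop : Within b (.loop f body) s₁ (N * ((B + 4) + 1) + 1)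
      (fun s' => J N s' ∧ s'.reg i = N ∧ s'.reg f = if N < N then 1 else 0) := by
    refine within_loop (fun j s' => J j s' ∧ s'.reg i = j ∧
      s'.reg f = if j < N then 1 else 0) ⟨hins _ _ _ _ h0, ?_, ?_⟩ ?_ ?_
    · simp [hs₁, Store.setReg, Function.update_of_ne hfi.symm]
    · simp [hs₁, Store.setReg, BinOp.eval, Function.update_of_ne him.symm, hm]
    · rintro j hj s' hF ⟨hJ, hij, hfj⟩
      have hm' : s'.reg m = N := by
        rw [hF.reg m (by simp [hbodydef, Cmd.writesReg, hcm, him, hfm]), hm1]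
      have h3' : s'.reg 3 = 1 := by
        rw [hF.reg 3 (by simp [hbodydef, Cmd.writesReg, hc3, hi3, hf3]), h31]
      refine ⟨by simp [hfj, hj], ?_⟩
      refine (hbody j hj s' (hFr s' hF) hij hJ).seq (fun s'' hF' hJ' => ?_) le_rfl
      refine within_straight rfl (by simp [Cmd.steps]) ?_
      have e1 : s''.reg i = j := (hF'.reg i hci).trans hij
      have e2 : s''.reg m = N := (hF'.reg m hcm).trans hm'
      have e3 : s''.reg 3 = 1 := (hF'.reg 3 hc3).trans h3'
      have e4 : (j + 1) % 2 ^ b = j + 1 := Nat.mod_eq_of_lt (by omega)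
      refine ⟨hins _ _ _ _ hJ', ?_, ?_⟩
      · simp [Cmd.effect, Store.setReg, BinOp.eval, Function.update_of_ne hfi.symm, e1, e3, e4]
      · simp [Cmd.effect, Store.setReg, BinOp.eval, Function.update_of_ne him.symm, e1, e2, e3, e4]
    · rintro s' ⟨-, -, h⟩
      simpa using h
  obtain ⟨t, s', ht, he, hJ, -⟩ := hloop
  refine ⟨1 + (1 + t + 1) + 1, s', ?_, .seq (.const i 0 s) (.seq (.op .lt f i m _) he), hJ⟩
  rw [show B + 4 + 1 = B + 5 from rfl] at ht
  omega

/-! ### The program -/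

/-- Register `15` becomes `1` if labelling the vertex in register `11` by register `12` and the
vertex in register `13` by register `14` violates their edge, otherwise `0`. Registers `0`, `2`,
`3`, `4` always hold the numbers `n`, `q`, `1`, `0`. -/
def violCmd : Cmd :=
  .seq (.op .mul 15 11 0) <| .seq (.op .add 15 15 13) <| .seq (.op .mul 15 15 2) <|
  .seq (.op .add 15 15 12) <| .seq (.load 15 0 15) <| .seq (.op .eq 15 15 14) <|
  .seq (.op .eq 16 11 13) <| .seq (.op .add 15 15 16) (.op .eq 15 15 4)

/-- Register `21` becomes the number of conflicts of the vertex in register `11`, labelled by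
register `12`, with as many vertices of array `W`, labelled by array `Y`, as register `17` says. -/
def countCmd (W Y : ℕ) : Cmd :=
  .seq (.const 21 0) <| forTo 22 17 23 <|
    .seq (.load 13 W 22) <| .seq (.load 14 Y 22) <| .seq violCmd (.op .add 21 21 15)

/-- Register `18` becomes the greedy label of the vertex in register `11` against as many vertices
of array `W`, labelled by array `Y`, as register `17` says. -/
def replyCmd (W Y : ℕ) : Cmd :=
  .seq (.const 18 0) <| .seq (.op .add 20 17 3) <| forTo 12 2 19 <|
    .seq (countCmd W Y) <| .seq (.op .lt 24 21 20) <|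
      .cond 24 (.seq (.move 20 21) (.move 18 12)) .skip

/-- Register `27` becomes the cost of the assignment in array `5`. -/
def costCmd : Cmd :=
  .seq (.const 27 0) <| forTo 11 0 25 <| .seq (.load 12 5 11) <| forTo 13 0 26 <|
    .seq (.load 14 5 13) <| .seq violCmd (.op .add 27 27 15)

/-- If the assignment in array `5` costs less than register `10` says, copy it to array `1` and its
cost to register `10`. -/
def considerCmd : Cmd :=
  .seq costCmd <| .seq (.op .lt 24 27 10) <|
    .cond 24 (.seq (.move 10 27) (forTo 11 0 25 (.seq (.load 12 5 11) (.write 1 11 12)))) .skip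

/-- Store the labels propagated from the vertex in register `28`, labelled by register `29`, in
array `7`, and the list of all vertices in array `6`. -/
def propagateCmd : Cmd :=
  forTo 13 0 26 <| .seq (.write 6 13 13) <| .seq (.op .eq 24 28 13) <|
    .cond 24 (.write 7 13 29) <|
      .seq (.op .mul 15 28 0) <| .seq (.op .add 15 15 13) <| .seq (.op .mul 15 15 2) <|
      .seq (.op .add 15 15 29) <| .seq (.load 15 0 15) (.write 7 13 15)

/-- Consider the candidates of all pivots. -/
def pivotCmd : Cmd :=
  forTo 28 0 30 <| forTo 29 2 31 <| .seq propagateCmd <| .seq (.move 17 0) <|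
    .seq (forTo 11 0 25 (.seq (replyCmd 6 7) (.write 5 11 18))) considerCmd

/-- Label the sample greedily. Array `2` holds the sampled vertices, array `4` their labels,
register `6` the number of guessed labels and register `7` the size of the sample. -/
def labelCmd : Cmd :=
  forTo 17 7 25 <| .seq (.op .lt 24 17 6) <|
    .cond 24 .skip (.seq (.load 11 2 17) (.seq (replyCmd 2 4) (.write 4 17 18)))

/-- Replace the guess in array `4`, read as the digits of a number in base `q`, by its successor.
Register `32` becomes `0` in case of an overflow, otherwise `1`. -/
def nextCmd : Cmd :=
  .seq (.const 32 1) <| .seq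
    (forTo 22 6 23 <| .cond 32
      (.seq (.load 15 4 22) <| .seq (.op .add 15 15 3) <| .seq (.op .eq 16 15 2) <|
        .cond 16 (.write 4 22 4) (.seq (.write 4 22 15) (.const 32 0)))
      .skip)
    (.op .eq 32 32 4)

/-- Consider the candidates of all guesses for the sample. Array `3` holds the number of sampled
vertices that each vertex is labelled against. -/
def sampleCmd : Cmd :=
  .seq (.const 32 1) <| .loop 32 <| .seq labelCmd <|
    .seq (forTo 11 0 25 (.seq (.load 17 3 11) (.seq (replyCmd 2 4) (.write 5 11 18)))) <|
    .seq considerCmd nextCmd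

/-! ### Correctness and running time of the program -/

/-- The memory `s` holds the instance `I` and the numbers that the program takes for granted. -/
structure Env {n q : ℕ} (I : Instance n q) (s : Store) : Prop where
  n : s.reg 0 = n
  q : s.reg 2 = q
  one : s.reg 3 = 1
  zero : s.reg 4 = 0
  table : s.arr 0 = I.table

theorem Env.of_frame {n q : ℕ} {I : Instance n q} {c : Cmd} {s s' : Store} (h : Env I s)
    (hF : Frame c s s')
    (hc : (c.writesReg 0 || c.writesReg 2 || c.writesReg 3 || c.writesReg 4 || c.writesArr 0) =
      false) : Env I s' := by
  simp only [Bool.or_eq_false_iff] at hc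
  obtain ⟨⟨⟨⟨h0, h2⟩, h3⟩, h4⟩, ha⟩ := hc
  exact ⟨(hF.reg _ h0).trans h.n, (hF.reg _ h2).trans h.q, (hF.reg _ h3).trans h.one,
    (hF.reg _ h4).trans h.zero, (hF.arr _ ha).trans h.table⟩

section

variable {n q b : ℕ} {I : Instance n q} {s : Store}

theorem index_lt (v w : Fin n) (a : Fin q) : ((v : ℕ) * n + w) * q + a < n * n * q := by
  have h1 : (v : ℕ) * n + w + 1 ≤ n * n := by
    calc (v : ℕ) * n + w + 1 ≤ v * n + n := by omega
      _ = (v + 1) * n := by ring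
      _ ≤ n * n := Nat.mul_le_mul_right _ v.2
  calc ((v : ℕ) * n + w) * q + a < (v * n + w) * q + q := by omega
    _ = (v * n + w + 1) * q := by ring
    _ ≤ n * n * q := Nat.mul_le_mul_right _ h1

theorem within_viol (hE : Env I s) (hb : n * n * q + 2 < 2 ^ b) {v w : Fin n} {a c : Fin q}
    (hv : s.reg 11 = v) (ha : s.reg 12 = a) (hw : s.reg 13 = w) (hc : s.reg 14 = c) :
    Within b violCmd s 17 (fun s' => s'.reg 15 = I.viol v a w c) := by
  refine within_straight rfl le_rfl ?_
  have hlt := index_lt v w a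
  have hq : 1 ≤ q := a.pos
  have h3 : (v : ℕ) * n + w ≤ (v * n + w) * q := Nat.le_mul_of_pos_right _ hq
  have e1 : ((v : ℕ) * n) % 2 ^ b = v * n := Nat.mod_eq_of_lt (by omega)
  have e2 : ((v : ℕ) * n + w) % 2 ^ b = v * n + w := Nat.mod_eq_of_lt (by omega)
  have e3 : (((v : ℕ) * n + w) * q) % 2 ^ b = (v * n + w) * q := Nat.mod_eq_of_lt (by omega)
  have e4 : (((v : ℕ) * n + w) * q + a) % 2 ^ b = (v * n + w) * q + a :=
    Nat.mod_eq_of_lt (by omega)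
  have e5 : 1 % 2 ^ b = 1 := Nat.mod_eq_of_lt (by omega)
  have e6 : (1 + 1) % 2 ^ b = 2 := Nat.mod_eq_of_lt (by omega)
  rcases eq_or_ne v w with rfl | h2
  · by_cases h1 : I.perm v v a = c <;>
      simp [violCmd, Cmd.effect, Store.setReg, BinOp.eval, hE.n, hE.q, hE.table, hE.zero, hv, ha,
        hw, hc, e1, e2, e3, e4, e5, e6, I.table_apply, Instance.viol, Fin.val_inj, h1]
  · by_cases h1 : I.perm v w a = c <;>
      simp [violCmd, Cmd.effect, Store.setReg, BinOp.eval, hE.n, hE.q, hE.table, hE.zero, hv, ha,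
        hw, hc, e1, e2, e3, e4, e5, I.table_apply, Instance.viol, Fin.val_inj, h1, h2]

theorem within_count (hE : Env I s) {W Y len : ℕ} (hb : n * n * q + 2 < 2 ^ b)
    (hlen : len < 2 ^ b) {v : Fin n} {a : Fin q} (hv : s.reg 11 = v) (ha : s.reg 12 = a)
    (hl : s.reg 17 = len) {U : ℕ → Fin n} {L : ℕ → Fin q} (hU : ∀ j < len, s.arr W j = U j)
    (hL : ∀ j < len, s.arr Y j = L j) :
    Within b (countCmd W Y) s (len * 28 + 7) (fun s' => s'.reg 21 = I.conflicts U L len v a) := by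
  refine Within.seq (Q := fun s' => s'.reg 21 = 0) (within_straight rfl le_rfl ?_)
    (fun s₁ hF₁ h21 => ?_) (M := len * 28 + 5) (by simp [Cmd.steps]; omega)
  · simp [Cmd.effect, Store.setReg]
  refine within_forTo (N := len) (B := 23) (fun j s' => s'.reg 21 = I.conflicts U L j v a)
    ((hF₁.reg 17 rfl).trans hl) ((hF₁.reg 3 rfl).trans hE.one) hlen rfl rfl ?_ ?_ ?_ (by omega)
  · intro j s' w w' h
    simpa [Store.setReg] using h
  · simpa [Instance.conflicts] using h21
  · intro j hj s₂ hF₂ hj₂ hJ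
    refine Within.seq (Q := fun s' => s'.reg 13 = U j) (within_straight rfl le_rfl ?_)
      (fun s₃ hF₃ h13 => ?_) (M := 21) (by simp [Cmd.steps])
    · simp [Cmd.effect, Store.setReg, hj₂, hF₂.arr W rfl, hF₁.arr W rfl, hU j hj]
    refine Within.seq (Q := fun s' => s'.reg 14 = L j) (within_straight rfl le_rfl ?_)
      (fun s₄ hF₄ h14 => ?_) (M := 19) (by simp [Cmd.steps])
    · simp [Cmd.effect, Store.setReg, hF₃.reg 22 rfl, hj₂, hF₃.arr Y rfl, hF₂.arr Y rfl,
        hF₁.arr Y rfl, hL j hj]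
    have hE₄ : Env I s₄ := (((hE.of_frame hF₁ rfl).of_frame hF₂ rfl).of_frame hF₃ rfl).of_frame
      hF₄ rfl
    refine Within.seq (within_viol hE₄ hb (v := v) (w := U j) (a := a) (c := L j) ?_ ?_ ?_ h14)
      (fun s₅ hF₅ h15 => ?_) (M := 1) le_rfl
    · rw [hF₄.reg 11 rfl, hF₃.reg 11 rfl, hF₂.reg 11 rfl, hF₁.reg 11 rfl, hv]
    · rw [hF₄.reg 12 rfl, hF₃.reg 12 rfl, hF₂.reg 12 rfl, hF₁.reg 12 rfl, ha]
    · rw [hF₄.reg 13 rfl, h13]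
    refine within_straight rfl le_rfl ?_
    have h21' : s₅.reg 21 = I.conflicts U L j v a := by
      rw [hF₅.reg 21 rfl, hF₄.reg 21 rfl, hF₃.reg 21 rfl, hJ]
    have hsucc : I.conflicts U L (j + 1) v a =
        I.conflicts U L j v a + I.viol v a (U j) (L j) := Finset.sum_range_succ _ _
    have hle := I.conflicts_le U L (j + 1) v a
    simp only [Cmd.effect, Store.setReg, BinOp.eval, Function.update_self, h21', h15]
    rw [← hsucc, Nat.mod_eq_of_lt (by omega)]

theorem within_reply [NeZero q] (hE : Env I s) {W Y len : ℕ} (hb : n * n * q + 2 < 2 ^ b)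
    (hqb : q < 2 ^ b) (hlen : len + 1 < 2 ^ b) {v : Fin n} (hv : s.reg 11 = v)
    (hl : s.reg 17 = len) {U : ℕ → Fin n} {L : ℕ → Fin q} (hU : ∀ j < len, s.arr W j = U j)
    (hL : ∀ j < len, s.arr Y j = L j) :
    Within b (replyCmd W Y) s (q * (len * 28 + 19) + 9)
      (fun s' => s'.reg 18 = I.reply U L len v) := by
  refine Within.seq (Q := fun _ => True) (within_straight rfl le_rfl trivial)
    (fun s₁ hF₁ _ => ?_) (M := q * (len * 28 + 19) + 7) (by simp [Cmd.steps]; omega)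
  refine Within.seq (Q := fun s' => s'.reg 20 = len + 1) (within_straight rfl le_rfl ?_)
    (fun s₂ hF₂ h20 => ?_) (M := q * (len * 28 + 19) + 5) (by simp [Cmd.steps]; omega)
  · simp [Cmd.effect, Store.setReg, BinOp.eval, hF₁.reg 17 rfl, hF₁.reg 3 rfl, hl, hE.one,
      Nat.mod_eq_of_lt hlen]
  have hE₂ : Env I s₂ := (hE.of_frame hF₁ rfl).of_frame hF₂ rfl
  set f : Fin q → ℕ := I.conflicts U L len v with hf
  refine (within_forTo (N := q) (B := len * 28 + 14) (L := q * (len * 28 + 19) + 5)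
    (fun a s' => (a = 0 ∧ s'.reg 20 = len + 1) ∨ ∃ l : Fin q, s'.reg 18 = l ∧ s'.reg 20 = f l ∧
      (l : ℕ) < a ∧ (∀ c : Fin q, (c : ℕ) < a → f l ≤ f c) ∧ ∀ c < l, f l < f c)
    hE₂.q hE₂.one hqb rfl rfl ?_ (Or.inl ⟨rfl, h20⟩) ?_ le_rfl).conseq ?_ le_rfl
  · intro j s' w w' h
    simpa [Store.setReg] using h
  · intro j hj s₃ hF₃ hj₃ hJ
    set a : Fin q := ⟨j, hj⟩ with ha
    refine Within.seq (within_count (hE₂.of_frame hF₃ rfl) hb (v := v) (a := a) (U := U) (L := L)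
      (len := len) (by omega) ?_ hj₃ ?_ ?_ ?_) (fun s₄ hF₄ h21' => ?_) (M := 6) (by omega)
    · rw [hF₃.reg 11 rfl, hF₂.reg 11 rfl, hF₁.reg 11 rfl, hv]
    · rw [hF₃.reg 17 rfl, hF₂.reg 17 rfl, hF₁.reg 17 rfl, hl]
    · intro i hi
      rw [hF₃.arr W rfl, hF₂.arr W rfl, hF₁.arr W rfl, hU i hi]
    · intro i hi
      rw [hF₃.arr Y rfl, hF₂.arr Y rfl, hF₁.arr Y rfl, hL i hi]
    refine within_straight rfl le_rfl ?_
    have h21 : s₄.reg 21 = f a := h21'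
    have h12 : s₄.reg 12 = a := (hF₄.reg 12 rfl).trans hj₃
    have h18 : s₄.reg 18 = s₃.reg 18 := hF₄.reg 18 rfl
    have h20' : s₄.reg 20 = s₃.reg 20 := hF₄.reg 20 rfl
    by_cases hlt : f a < s₃.reg 20
    · refine Or.inr ⟨a, ?_, ?_, Nat.lt_succ_self j, ?_, ?_⟩
      · simp [Cmd.effect, Store.setReg, BinOp.eval, h21, h20', hlt, h12]
      · simp [Cmd.effect, Store.setReg, BinOp.eval, h21, h20', hlt]
      · intro c hc
        rcases Nat.lt_succ_iff_lt_or_eq.1 hc with hc | hc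
        · rcases hJ with ⟨h0, -⟩ | ⟨l, -, hl20, -, hmin, -⟩
          · omega
          · have := hmin c hc
            omega
        · rw [show c = a from Fin.ext hc]
      · intro c hc
        rcases hJ with ⟨h0, -⟩ | ⟨l, -, hl20, -, hmin, -⟩
        · have : (c : ℕ) < j := hc
          omega
        · have := hmin c hc
          omega
    · rcases hJ with ⟨-, h⟩ | ⟨l, hl18, hl20, hla, hmin, hfirst⟩
      · have : f a ≤ len := I.conflicts_le U L len v a
        omega
      · refine Or.inr ⟨l, ?_, ?_, by omega, ?_, hfirst⟩
        · simp [Cmd.effect, Store.setReg, BinOp.eval, h21, h20', hlt, h18, hl18]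
        · rw [hl20] at hlt
          simp [Cmd.effect, Store.setReg, BinOp.eval, h21, h20', hlt, hl20]
        · intro c hc
          rcases Nat.lt_succ_iff_lt_or_eq.1 hc with hc | hc
          · exact hmin c hc
          · rw [show c = a from Fin.ext hc]
            omega
  · rintro s' - (⟨h0, -⟩ | ⟨l, h18, -, -, hmin, hfirst⟩)
    · exact absurd h0 (NeZero.ne q)
    · rw [h18, Instance.reply, ← eq_firstMin f l (fun c => hmin c c.2) hfirst]

theorem within_cost [NeZero n] (hE : Env I s) (hb : n * n * q + 2 < 2 ^ b) {z : Fin n → Fin q}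
    (hz : ∀ v : Fin n, s.arr 5 v = z v) :
    Within b costCmd s (n * (n * 26 + 12) + 7) (fun s' => s'.reg 27 = I.cost z) := by
  have hq : 1 ≤ q := (z 0).pos
  have hn : n ≤ n * n := Nat.le_mul_self n
  have hnq : n * n ≤ n * n * q := Nat.le_mul_of_pos_right _ hq
  refine Within.seq (Q := fun s' => s'.reg 27 = 0) (within_straight rfl le_rfl ?_)
    (fun s₁ hF₁ h27 => ?_) (M := n * (n * 26 + 12) + 5) (by simp [Cmd.steps]; omega)
  · simp [Cmd.effect, Store.setReg]
  have hE₁ := hE.of_frame hF₁ rfl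
  set g : ℕ → ℕ → ℕ := fun i j =>
    if h : i < n ∧ j < n then I.viol ⟨i, h.1⟩ (z ⟨i, h.1⟩) ⟨j, h.2⟩ (z ⟨j, h.2⟩) else 0 with hg
  have hg1 : ∀ i j, g i j ≤ 1 := by
    intro i j
    simp only [hg]
    split_ifs
    · exact I.viol_le_one _ _ _ _
    · simp
  have hcost : ∑ i ∈ Finset.range n, ∑ j ∈ Finset.range n, g i j = I.cost z := by
    rw [Finset.sum_range]
    refine Finset.sum_congr rfl fun v _ => ?_
    rw [Finset.sum_range]
    exact Finset.sum_congr rfl fun w _ => dif_pos ⟨v.2, w.2⟩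
  have hrow : ∀ i m, ∑ j ∈ Finset.range m, g i j ≤ m := fun i m =>
    (Finset.sum_le_sum fun j _ => hg1 i j).trans (by simp)
  have hrows : ∀ m, ∑ i ∈ Finset.range m, ∑ j ∈ Finset.range n, g i j ≤ m * n := fun m =>
    (Finset.sum_le_sum fun i _ => hrow i n).trans (by simp)
  refine (within_forTo (N := n) (B := n * 26 + 7) (L := n * (n * 26 + 12) + 5)
    (fun i s' => s'.reg 27 = ∑ i ∈ Finset.range i, ∑ j ∈ Finset.range n, g i j)
    hE₁.n hE₁.one (by omega) rfl rfl ?_ (by simpa using h27) ?_ le_rfl).conseq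
      (fun s' _ h => h.trans hcost) le_rfl
  · intro j s' w w' h
    simpa [Store.setReg] using h
  intro i hi s₂ hF₂ hi₂ hJ
  refine Within.seq (Q := fun s' => s'.reg 12 = z ⟨i, hi⟩) (within_straight rfl le_rfl ?_)
    (fun s₃ hF₃ h12 => ?_) (M := n * 26 + 5) (by simp [Cmd.steps]; omega)
  · simp [Cmd.effect, Store.setReg, hi₂, hF₂.arr 5 rfl, hF₁.arr 5 rfl, hz ⟨i, hi⟩]
  have hE₃ : Env I s₃ := (hE₁.of_frame hF₂ rfl).of_frame hF₃ rfl
  refine (within_forTo (N := n) (B := 21) (L := n * 26 + 5)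
    (fun j s' => s'.reg 27 = ∑ i ∈ Finset.range i, ∑ j ∈ Finset.range n, g i j +
      ∑ j ∈ Finset.range j, g i j)
    hE₃.n hE₃.one (by omega) rfl rfl ?_ ?_ ?_ le_rfl).conseq ?_ le_rfl
  · intro j s' w w' h
    simpa [Store.setReg] using h
  · simp [hF₃.reg 27 rfl, hJ]
  · intro j hj s₄ hF₄ hj₄ hJ₄
    refine Within.seq (Q := fun s' => s'.reg 14 = z ⟨j, hj⟩) (within_straight rfl le_rfl ?_)
      (fun s₅ hF₅ h14 => ?_) (M := 19) (by simp [Cmd.steps])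
    · simp [Cmd.effect, Store.setReg, hj₄, hF₄.arr 5 rfl, hF₃.arr 5 rfl, hF₂.arr 5 rfl,
        hF₁.arr 5 rfl, hz ⟨j, hj⟩]
    have hE₅ : Env I s₅ := (hE₃.of_frame hF₄ rfl).of_frame hF₅ rfl
    refine Within.seq (within_viol hE₅ hb (v := ⟨i, hi⟩) (w := ⟨j, hj⟩) (a := z ⟨i, hi⟩)
      (c := z ⟨j, hj⟩) ?_ ?_ ?_ h14) (fun s₆ hF₆ h15 => ?_) (M := 1) le_rfl
    · rw [hF₅.reg 11 rfl, hF₄.reg 11 rfl, hF₃.reg 11 rfl, hi₂]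
    · rw [hF₅.reg 12 rfl, hF₄.reg 12 rfl, h12]
    · rw [hF₅.reg 13 rfl, hj₄]
    refine within_straight rfl le_rfl ?_
    have h27' : s₆.reg 27 = s₄.reg 27 := (hF₆.reg 27 rfl).trans (hF₅.reg 27 rfl)
    have hgij : I.viol ⟨i, hi⟩ (z ⟨i, hi⟩) ⟨j, hj⟩ (z ⟨j, hj⟩) = g i j := by
      simp only [hg]
      rw [dif_pos ⟨hi, hj⟩]
    have h1 := hrows i
    have h2 := hrow i (j + 1)
    have h3 : (i + 1) * n ≤ n * n := Nat.mul_le_mul_right _ hi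
    rw [add_mul, one_mul] at h3
    rw [Finset.sum_range_succ] at h2 ⊢
    simp only [Cmd.effect, Store.setReg, BinOp.eval, Function.update_self, h27', hJ₄, h15, hgij]
    rw [Nat.mod_eq_of_lt (by omega), add_assoc]
  · intro s' _ h
    rw [Finset.sum_range_succ, h]

/-- Array `1` holds an assignment that costs at most the number in register `10`. -/
def HasBest (I : Instance n q) (s : Store) : Prop :=
  ∃ x : Fin n → Fin q, (∀ v : Fin n, s.arr 1 v = x v) ∧ I.cost x ≤ s.reg 10

theorem HasBest.congr {s' : Store} (h : HasBest I s) (h1 : s'.arr 1 = s.arr 1)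
    (h10 : s'.reg 10 = s.reg 10) : HasBest I s' := by
  obtain ⟨x, hx, hc⟩ := h
  exact ⟨x, fun v => by rw [h1, hx], by rw [h10]; exact hc⟩

theorem within_consider [NeZero n] (hE : Env I s) (hb : n * n * q + 2 < 2 ^ b)
    {z : Fin n → Fin q} (hz : ∀ v : Fin n, s.arr 5 v = z v) (hbest : HasBest I s) :
    Within b considerCmd s (n * (n * 26 + 20) + 18)
      (fun s' => HasBest I s' ∧ s'.reg 10 ≤ s.reg 10 ∧ s'.reg 10 ≤ I.cost z) := by
  have hq : 1 ≤ q := (z 0).pos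
  have hn : n ≤ n * n := Nat.le_mul_self n
  have hnq : n * n ≤ n * n * q := Nat.le_mul_of_pos_right _ hq
  refine Within.seq (within_cost hE hb hz) (fun s₁ hF₁ h27 => ?_) (M := n * 8 + 10) (by
    rw [show n * (n * 26 + 20) = n * (n * 26 + 12) + n * 8 by ring]; omega)
  have h10 := hF₁.reg 10 rfl
  refine Within.seq (Q := fun s' => s'.reg 24 = if I.cost z < s.reg 10 then 1 else 0)
    (within_straight rfl le_rfl ?_) (fun s₂ hF₂ h24 => ?_) (M := n * 8 + 8)
    (by simp [Cmd.steps]; omega)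
  · simp [Cmd.effect, Store.setReg, BinOp.eval, h27, h10]
  refine Within.cond (N := n * 8 + 7) (fun hx => ?_) (fun hx => ?_) le_rfl
  · have hlt : I.cost z < s.reg 10 := by
      by_contra h
      exact hx (by rw [h24, if_neg h])
    refine Within.seq (Q := fun s' => s'.reg 10 = I.cost z) (within_straight rfl le_rfl ?_)
      (fun s₃ hF₃ h10₃ => ?_) (M := n * 8 + 5) (by simp [Cmd.steps]; omega)
    · simp [Cmd.effect, Store.setReg, hF₂.reg 27 rfl, h27]
    have hE₃ : Env I s₃ := ((hE.of_frame hF₁ rfl).of_frame hF₂ rfl).of_frame hF₃ rfl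
    refine (within_forTo (N := n) (B := 3) (L := n * 8 + 5)
      (fun i s' => ∀ v : Fin n, (v : ℕ) < i → s'.arr 1 v = z v)
      hE₃.n hE₃.one (by omega) rfl rfl ?_ ?_ ?_ le_rfl).conseq ?_ le_rfl
    · intro j s' w w' h
      exact h
    · intro v hv
      omega
    · intro i hi s₄ hF₄ hi₄ hJ
      refine within_straight rfl le_rfl ?_
      intro v hv
      have h5 : s₄.arr 5 = s.arr 5 := by
        rw [hF₄.arr 5 rfl, hF₃.arr 5 rfl, hF₂.arr 5 rfl, hF₁.arr 5 rfl]
      rcases Nat.lt_succ_iff_lt_or_eq.1 hv with hv | hv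
      · simp [Cmd.effect, Store.setReg, Store.setArr, hi₄, hv.ne, hJ v hv]
      · simp [Cmd.effect, Store.setReg, Store.setArr, hi₄, ← hv, h5, hz v]
    · intro s' hF hJ
      have : s'.reg 10 = I.cost z := (hF.reg 10 rfl).trans h10₃
      exact ⟨⟨z, fun v => hJ v v.2, this.ge⟩, by omega, by omega⟩
  · have hge : s.reg 10 ≤ I.cost z := by
      by_contra h
      rw [h24, if_pos (not_le.1 h)] at hx
      exact one_ne_zero hx
    refine within_straight rfl (by simp [Cmd.steps]) ?_
    have h10₂ : s₂.reg 10 = s.reg 10 := (hF₂.reg 10 rfl).trans h10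
    refine ⟨hbest.congr ?_ h10₂, h10₂.le, h10₂.trans_le hge⟩
    exact (hF₂.arr 1 rfl).trans (hF₁.arr 1 rfl)

theorem within_propagate [NeZero n] (hE : Env I s) (hb : n * n * q + 2 < 2 ^ b) {u : Fin n}
    {a : Fin q} (hu : s.reg 28 = u) (ha : s.reg 29 = a) :
    Within b propagateCmd s (n * 21 + 5) (fun s' => ∀ j : Fin n, s'.arr 6 j = j ∧
      s'.arr 7 j = I.pivot u a j) := by
  have hq : 1 ≤ q := a.pos
  have hnb : n < 2 ^ b := by
    have h1 : n ≤ n * n := Nat.le_mul_self n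
    have h2 : n * n ≤ n * n * q := Nat.le_mul_of_pos_right _ hq
    omega
  refine (within_forTo (N := n) (B := 16) (L := n * 21 + 5)
    (fun i s' => ∀ j : Fin n, (j : ℕ) < i → s'.arr 6 j = j ∧ s'.arr 7 j = I.pivot u a j)
    hE.n hE.one hnb rfl rfl ?_ ?_ ?_ (le_of_eq (by ring))).conseq (fun s' _ h j => h j j.2) le_rfl
  · intro j s' w w' h
    exact h
  · intro j hj
    omega
  intro i hi s₁ hF₁ hi₁ hJ
  refine within_straight rfl le_rfl ?_
  have hE₁ := hE.of_frame hF₁ rfl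
  have h28 : s₁.reg 28 = u := (hF₁.reg 28 rfl).trans hu
  have h29 : s₁.reg 29 = a := (hF₁.reg 29 rfl).trans ha
  have hlt := index_lt u ⟨i, hi⟩ a
  simp only at hlt
  have h3 : (u : ℕ) * n + i ≤ (u * n + i) * q := Nat.le_mul_of_pos_right _ hq
  have e1 : ((u : ℕ) * n) % 2 ^ b = u * n := Nat.mod_eq_of_lt (by omega)
  have e2 : ((u : ℕ) * n + i) % 2 ^ b = u * n + i := Nat.mod_eq_of_lt (by omega)
  have e3 : (((u : ℕ) * n + i) * q) % 2 ^ b = (u * n + i) * q := Nat.mod_eq_of_lt (by omega)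
  have e4 : (((u : ℕ) * n + i) * q + a) % 2 ^ b = (u * n + i) * q + a :=
    Nat.mod_eq_of_lt (by omega)
  have htab := I.table_apply u ⟨i, hi⟩ a
  simp only at htab
  intro j hj
  by_cases hui : (u : ℕ) = i
  · have hui' : u = ⟨i, hi⟩ := Fin.ext hui
    rcases Nat.lt_succ_iff_lt_or_eq.1 hj with hj | hj
    · have := hJ j hj
      simp [Cmd.effect, Store.setReg, Store.setArr, BinOp.eval, hi₁, h28, hui, hj.ne, this]
    · have : j = u := Fin.ext (hj.trans hui.symm)
      simp [Cmd.effect, Store.setReg, Store.setArr, BinOp.eval, hi₁, h28, h29, hui, this,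
        Instance.pivot]
  · rcases Nat.lt_succ_iff_lt_or_eq.1 hj with hj | hj
    · have := hJ j hj
      simp [Cmd.effect, Store.setReg, Store.setArr, BinOp.eval, hi₁, h28, hui, hj.ne, this]
    · have hji : j = ⟨i, hi⟩ := Fin.ext hj
      have hne : (⟨i, hi⟩ : Fin n) ≠ u := fun h => hui (by rw [← h])
      simp [Cmd.effect, Store.setReg, Store.setArr, BinOp.eval, hi₁, h28, h29, hui, hji,
        hE₁.n, hE₁.q, hE₁.table, e1, e2, e3, e4, htab, Instance.pivot, hne]

theorem reply_pivot [NeZero n] [NeZero q] (I : Instance n q) (u : Fin n) (a : Fin q) (v : Fin n) :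
    I.reply (Instance.extend fun w : Fin n => w)
      (I.pivot u a ∘ Instance.extend fun w : Fin n => w) n v =
      I.pivotReply u a v := by
  rw [Instance.reply, Instance.pivotReply]
  congr 1
  funext c
  rw [Instance.conflicts, Finset.sum_range, Instance.degreeCost]
  refine Finset.sum_congr rfl fun w _ => ?_
  simp [Instance.extend]

theorem within_pivot [NeZero n] [NeZero q] (hE : Env I s) (hb : n * n * q + 2 < 2 ^ b)
    (hqb : q < 2 ^ b) (hbest : HasBest I s) :
    Within b pivotCmd s
      (n * (q * (n * 21 + n * (q * (n * 28 + 19) + 16) + n * (n * 26 + 20) + 37) + 10) + 5)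
      (fun s' => HasBest I s' ∧ ∀ u a, s'.reg 10 ≤ I.cost (I.pivotReply u a)) := by
  have hq : 1 ≤ q := Nat.pos_of_ne_zero (NeZero.ne q)
  have hnb : n + 1 < 2 ^ b := by
    have h1 : n ≤ n * n := Nat.le_mul_self n
    have h2 : n * n ≤ n * n * q := Nat.le_mul_of_pos_right _ hq
    omega
  refine (within_forTo (N := n)
    (B := q * (n * 21 + n * (q * (n * 28 + 19) + 16) + n * (n * 26 + 20) + 37) + 5)
    (fun i s' => HasBest I s' ∧
      ∀ (u : Fin n) a, (u : ℕ) < i → s'.reg 10 ≤ I.cost (I.pivotReply u a))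
    hE.n hE.one (by omega) rfl rfl ?_ ?_ ?_ (le_of_eq (by ring))).conseq
      (fun s' _ h => ⟨h.1, fun u a => h.2 u a u.2⟩) le_rfl
  · intro j s' w w' h
    exact ⟨h.1.congr rfl (by simp [Store.setReg]), fun u a hu => by
      simpa [Store.setReg] using h.2 u a hu⟩
  · exact ⟨hbest, fun u a hu => by omega⟩
  intro i hi s₁ hF₁ hi₁ hJ₁
  have hE₁ := hE.of_frame hF₁ rfl
  refine (within_forTo (N := q)
    (B := n * 21 + n * (q * (n * 28 + 19) + 16) + n * (n * 26 + 20) + 32)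
    (fun c s' => HasBest I s' ∧ ∀ (u : Fin n) (a : Fin q),
      (u : ℕ) < i ∨ ((u : ℕ) = i ∧ (a : ℕ) < c) → s'.reg 10 ≤ I.cost (I.pivotReply u a))
    hE₁.q hE₁.one hqb rfl rfl ?_ ?_ ?_ (le_of_eq (by ring))).conseq ?_ le_rfl
  · intro j s' w w' h
    exact ⟨h.1.congr rfl (by simp [Store.setReg]), fun u a hu => by
      simpa [Store.setReg] using h.2 u a hu⟩
  · exact ⟨hJ₁.1, fun u a hu => hJ₁.2 u a (by omega)⟩
  · intro c hc s₂ hF₂ hc₂ hJ₂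
    have hE₂ := hE₁.of_frame hF₂ rfl
    set u : Fin n := ⟨i, hi⟩ with hudef
    set a : Fin q := ⟨c, hc⟩ with hadef
    refine Within.seq (within_propagate hE₂ hb (u := u) (a := a) ((hF₂.reg 28 rfl).trans hi₁) hc₂)
      (fun s₃ hF₃ h67 => ?_)
      (M := n * (q * (n * 28 + 19) + 16) + n * (n * 26 + 20) + 26) (by omega)
    have hE₃ := hE₂.of_frame hF₃ rfl
    refine Within.seq (Q := fun s' => s'.reg 17 = n) (within_straight rfl le_rfl ?_)
      (fun s₄ hF₄ h17 => ?_)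
      (M := n * (q * (n * 28 + 19) + 16) + n * (n * 26 + 20) + 24) (by simp [Cmd.steps]; omega)
    · simp [Cmd.effect, Store.setReg, hE₃.n]
    have hE₄ := hE₃.of_frame hF₄ rfl
    have hz : Within b (forTo 11 0 25 (.seq (replyCmd 6 7) (.write 5 11 18))) s₄
        (n * (q * (n * 28 + 19) + 16) + 5)
        (fun s' => ∀ v : Fin n, s'.arr 5 v = I.pivotReply u a v) := by
      refine (within_forTo (N := n) (B := q * (n * 28 + 19) + 11)
        (L := n * (q * (n * 28 + 19) + 16) + 5)
        (fun i s' => ∀ v : Fin n, (v : ℕ) < i → s'.arr 5 v = I.pivotReply u a v)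
        hE₄.n hE₄.one (by omega) rfl rfl (fun j s' w w' h => h) (fun v hv => by omega) ?_
        (le_of_eq (by ring))).conseq (fun s' _ h v => h v v.2) le_rfl
      intro j hj s₅ hF₅ hj₅ hJ₅
      refine Within.seq (within_reply (hE₄.of_frame hF₅ rfl) (v := ⟨j, hj⟩) (len := n) hb hqb hnb
        hj₅ ((hF₅.reg 17 rfl).trans h17) (U := Instance.extend fun w : Fin n => w)
        (L := I.pivot u a ∘ Instance.extend fun w : Fin n => w) ?_ ?_) (fun s₆ hF₆ h18 => ?_)
        (M := 1) (by omega)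
      · intro j hj
        rw [hF₅.arr 6 rfl, hF₄.arr 6 rfl, (h67 ⟨j, hj⟩).1]
        simp [Instance.extend, hj]
      · intro j hj
        rw [hF₅.arr 7 rfl, hF₄.arr 7 rfl, (h67 ⟨j, hj⟩).2]
        simp [Instance.extend, hj]
      refine within_straight rfl le_rfl ?_
      rw [reply_pivot] at h18
      have h11 : s₆.reg 11 = j := (hF₆.reg 11 rfl).trans hj₅
      intro v hv
      rcases Nat.lt_succ_iff_lt_or_eq.1 hv with hv | hv
      · simp [Cmd.effect, Store.setArr, h11, hv.ne, hF₆.arr 5 rfl, hJ₅ v hv]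
      · have : v = ⟨j, hj⟩ := Fin.ext hv
        simp [Cmd.effect, Store.setArr, h11, this, h18]
    refine Within.seq hz (fun s₅ hF₅ h5 => ?_) (M := n * (n * 26 + 20) + 18) (by omega)
    have e10 : s₅.reg 10 = s₂.reg 10 := by
      rw [hF₅.reg 10 rfl, hF₄.reg 10 rfl, hF₃.reg 10 rfl]
    have e1 : s₅.arr 1 = s₂.arr 1 := by
      rw [hF₅.arr 1 rfl, hF₄.arr 1 rfl, hF₃.arr 1 rfl]
    refine (within_consider (hE₄.of_frame hF₅ rfl) hb h5 (hJ₂.1.congr e1 e10)).conseq ?_ le_rfl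
    rintro s₆ - ⟨hB, hle, hlez⟩
    refine ⟨hB, fun u' a' h => ?_⟩
    by_cases hnew : (u' : ℕ) = i ∧ (a' : ℕ) = c
    · rw [show u' = u from Fin.ext hnew.1, show a' = a from Fin.ext hnew.2]
      exact hlez
    · have := hJ₂.2 u' a' (by omega)
      omega
  · rintro s' - ⟨hB, h⟩
    exact ⟨hB, fun u a hu => h u a (by have := a.2; omega)⟩

/-- The guess whose labels are the digits of `N` in base `q`. -/
def guess (q : ℕ) [NeZero q] (N i : ℕ) : Fin q :=
  ⟨N / q ^ i % q, Nat.mod_lt _ (Nat.pos_of_ne_zero (NeZero.ne q))⟩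

theorem exists_guess_eq [NeZero q] (d : ℕ → Fin q) (t₀ : ℕ) :
    ∃ N < q ^ t₀, ∀ i < t₀, guess q N i = d i := by
  refine ⟨finFunctionFinEquiv (fun i : Fin t₀ => d i), Fin.is_lt _, fun i hi => ?_⟩
  have h := congrFun (finFunctionFinEquiv.symm_apply_apply (fun i : Fin t₀ => d i)) ⟨i, hi⟩
  rw [← h]
  rfl

theorem within_next [NeZero q] (hE : Env I s) (hqb : q < 2 ^ b) {t₀ N : ℕ} (h6 : s.reg 6 = t₀)
    (ht₀ : t₀ < 2 ^ b) (hN : N < q ^ t₀) (h4 : ∀ i < t₀, s.arr 4 i = guess q N i) :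
    Within b nextCmd s (t₀ * 16 + 9) (fun s' => (∀ i < t₀, s'.arr 4 i = guess q (N + 1) i) ∧
      s'.reg 32 = if N + 1 < q ^ t₀ then 1 else 0) := by
  have hq : 0 < q := Nat.pos_of_ne_zero (NeZero.ne q)
  have hb1 : 1 % 2 ^ b = 1 := Nat.mod_eq_of_lt (by omega)
  refine Within.seq (Q := fun s' => s'.reg 32 = 1) (within_straight rfl le_rfl ?_)
    (fun s₁ hF₁ h32 => ?_) (M := t₀ * 16 + 7) (by simp [Cmd.steps]; omega)
  · simp [Cmd.effect, Store.setReg, hb1]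
  have hE₁ := hE.of_frame hF₁ rfl
  -- Register `32` holds the carry: before digit `i` it is `1` iff all lower digits overflowed.
  refine Within.seq (within_forTo (N := t₀) (B := 11) (L := t₀ * 16 + 5)
    (fun i s' => (s'.reg 32 = if q ^ i ∣ N + 1 then 1 else 0) ∧
      (∀ j < i, s'.arr 4 j = guess q (N + 1) j) ∧ ∀ j < t₀, i ≤ j → s'.arr 4 j = guess q N j)
    ((hF₁.reg 6 rfl).trans h6) hE₁.one ht₀ rfl rfl ?_ ?_ ?_ le_rfl) (fun s₂ hF₂ hJ => ?_)
    (M := 1) (by omega)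
  · intro j s' w w' h
    simpa [Store.setReg] using h
  · exact ⟨by simp [h32], by omega, fun j hj _ => by rw [hF₁.arr 4 rfl, h4 j hj]⟩
  · rintro i hi s₃ hF₃ hi₃ ⟨hc, hlow, hhigh⟩
    refine within_straight rfl le_rfl ?_
    have hE₃ := hE₁.of_frame hF₃ rfl
    have hdig : s₃.arr 4 i = N / q ^ i % q := hhigh i hi le_rfl
    have hdlt : N / q ^ i % q < q := Nat.mod_lt _ hq
    have hmod : (N / q ^ i % q + 1) % 2 ^ b = N / q ^ i % q + 1 := Nat.mod_eq_of_lt (by omega)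
    have hpow : q ^ (i + 1) ∣ N + 1 ↔ q ^ i ∣ N + 1 ∧ q ∣ (N + 1) / q ^ i := by
      constructor
      · intro h
        have h1 : q ^ i ∣ N + 1 := (pow_dvd_pow q (Nat.le_succ i)).trans h
        exact ⟨h1, (Nat.dvd_div_iff_mul_dvd h1).2 (by rwa [← pow_succ])⟩
      · rintro ⟨h1, h2⟩
        rw [pow_succ]
        exact (Nat.dvd_div_iff_mul_dvd h1).1 h2
    have hsucc := Nat.succ_div (a := N) (b := q ^ i)
    by_cases hcar : q ^ i ∣ N + 1
    · rw [if_pos hcar] at hc hsucc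
      have hq1 : q ∣ (N + 1) / q ^ i ↔ N / q ^ i % q + 1 = q := by
        rw [hsucc, Nat.dvd_iff_mod_eq_zero, Nat.add_mod]
        rcases Nat.lt_or_ge (N / q ^ i % q + 1) q with h | h
        · have h1q : 1 < q := by omega
          rw [Nat.mod_eq_of_lt h1q, Nat.mod_eq_of_lt h]
          omega
        · have : N / q ^ i % q + 1 = q := by omega
          rw [Nat.add_mod_mod, this]
          simp
      by_cases hov : N / q ^ i % q + 1 = q
      · have hnew : (guess q (N + 1) i : ℕ) = 0 :=
          Nat.mod_eq_zero_of_dvd (hq1.2 hov)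
        refine ⟨?_, ?_, ?_⟩
        · rw [if_pos (hpow.2 ⟨hcar, hq1.2 hov⟩)]
          simp [Cmd.effect, Store.setReg, Store.setArr, BinOp.eval, hc, hi₃, hdig, hE₃.one, hE₃.q,
            Nat.mod_eq_of_lt hqb, hov]
        · intro j hj
          rcases Nat.lt_succ_iff_lt_or_eq.1 hj with hj | rfl
          · simp [Cmd.effect, Store.setReg, Store.setArr, BinOp.eval, hc, hi₃, hdig, hE₃.one,
              hE₃.q, Nat.mod_eq_of_lt hqb, hov, hj.ne, hlow j hj]
          · simp [Cmd.effect, Store.setReg, Store.setArr, BinOp.eval, hc, hi₃, hdig, hE₃.one,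
              hE₃.q, Nat.mod_eq_of_lt hqb, hov, hE₃.zero, hnew]
        · intro j hj hij
          have : j ≠ i := by omega
          simp [Cmd.effect, Store.setReg, Store.setArr, BinOp.eval, hc, hi₃, hdig, hE₃.one,
              hE₃.q, Nat.mod_eq_of_lt hqb, hov, this, hhigh j hj (by omega)]
      · have hnew : (guess q (N + 1) i : ℕ) = N / q ^ i % q + 1 := by
          have h1q : 1 < q := by omega
          change (N + 1) / q ^ i % q = _
          rw [hsucc, Nat.add_mod, Nat.mod_eq_of_lt h1q, Nat.mod_eq_of_lt (by omega)]
        refine ⟨?_, ?_, ?_⟩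
        · rw [if_neg (fun h => hov (hq1.1 (hpow.1 h).2))]
          simp [Cmd.effect, Store.setReg, Store.setArr, BinOp.eval, hc, hi₃, hdig, hE₃.one, hE₃.q,
            hmod, hov]
        · intro j hj
          rcases Nat.lt_succ_iff_lt_or_eq.1 hj with hj | rfl
          · simp [Cmd.effect, Store.setReg, Store.setArr, BinOp.eval, hc, hi₃, hdig, hE₃.one,
              hE₃.q, hmod, hov, hj.ne, hlow j hj]
          · simp [Cmd.effect, Store.setReg, Store.setArr, BinOp.eval, hc, hi₃, hdig, hE₃.one,
              hE₃.q, hmod, hov, hnew]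
        · intro j hj hij
          have : j ≠ i := by omega
          simp [Cmd.effect, Store.setReg, Store.setArr, BinOp.eval, hc, hi₃, hdig, hE₃.one,
              hE₃.q, hmod, hov, this, hhigh j hj (by omega)]
    · rw [if_neg hcar] at hc hsucc
      have hnew : (guess q (N + 1) i : ℕ) = N / q ^ i % q := by
        change (N + 1) / q ^ i % q = _
        rw [hsucc, add_zero]
      refine ⟨?_, ?_, ?_⟩
      · rw [if_neg (fun h => hcar (hpow.1 h).1)]
        simp [Cmd.effect, hc]
      · intro j hj
        rcases Nat.lt_succ_iff_lt_or_eq.1 hj with hj | rfl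
        · simp [Cmd.effect, hc, hlow j hj]
        · simp [Cmd.effect, hc, hdig, hnew]
      · intro j hj hij
        simp [Cmd.effect, hc, hhigh j hj (by omega)]
  · obtain ⟨hc, hlow, -⟩ := hJ
    refine within_straight rfl le_rfl ⟨fun i hi => ?_, ?_⟩
    · simp [Cmd.effect, Store.setReg, hlow i hi]
    · have hz : s₂.reg 4 = 0 := (hE₁.of_frame hF₂ rfl).zero
      have : q ^ t₀ ∣ N + 1 ↔ ¬ N + 1 < q ^ t₀ := by
        constructor
        · intro h
          exact not_lt.2 (Nat.le_of_dvd (Nat.succ_pos N) h)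
        · intro h
          rw [show N + 1 = q ^ t₀ by omega]
      by_cases h : N + 1 < q ^ t₀ <;>
        simp [Cmd.effect, Store.setReg, BinOp.eval, hc, hz, this, h]

/-- Array `4` is overwritten in place: its first `t₀` cells keep the guess, and cell `i` is final
after iteration `i`. -/
theorem within_label [NeZero q] (hE : Env I s) (hb : n * n * q + 2 < 2 ^ b)
    (hqb : q < 2 ^ b) {t₀ T : ℕ} (ht₀T : t₀ ≤ T) (hT : T + 1 < 2 ^ b) (h6 : s.reg 6 = t₀)
    (h7 : s.reg 7 = T) {U : ℕ → Fin n} (hU : ∀ j < T, s.arr 2 j = U j) {d : ℕ → Fin q}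
    (hd : ∀ j < t₀, s.arr 4 j = d j) :
    Within b labelCmd s (T * (q * (T * 28 + 19) + 21) + 5)
      (fun s' => ∀ j < T, s'.arr 4 j = I.sampleLabels d t₀ U T j) := by
  set Y := I.sampleLabels d t₀ U T with hY
  have hYval : ∀ j < T, Y j = if j < t₀ then d j else I.reply U Y j (U j) := by
    intro j hj
    have h1 : Y j = I.sampleLabels d t₀ U (j + 1) j :=
      I.sampleLabels_of_lt d t₀ U (Nat.lt_succ_self j) hj
    rw [h1, Instance.sampleLabels, Function.update_self]
    split_ifs
    · rfl
    · refine congrFun (I.reply_congr (fun _ _ => rfl) fun i hi => ?_) _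
      exact (I.sampleLabels_of_lt d t₀ U hi hj.le).symm
  refine (within_forTo (N := T) (B := q * (T * 28 + 19) + 16)
    (L := T * (q * (T * 28 + 19) + 21) + 5)
    (fun i s' => (∀ j < i, s'.arr 4 j = Y j) ∧ ∀ j < t₀, s'.arr 4 j = Y j)
    h7 hE.one (by omega) rfl rfl (fun j s' w w' h => h) ?_ ?_ (le_of_eq (by ring))).conseq
      (fun s' _ h => h.1) le_rfl
  · refine ⟨by omega, fun j hj => ?_⟩
    rw [hd j hj, hYval j (by omega), if_pos hj]
  rintro i hi s₁ hF₁ hi₁ ⟨hlow, hguess⟩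
  have hE₁ := hE.of_frame hF₁ rfl
  refine Within.seq (Q := fun s' => s'.reg 24 = if i < t₀ then 1 else 0)
    (within_straight rfl le_rfl ?_) (fun s₂ hF₂ h24 => ?_)
    (M := q * (T * 28 + 19) + 14) (by simp [Cmd.steps]; omega)
  · simp [Cmd.effect, Store.setReg, BinOp.eval, hi₁, hF₁.reg 6 rfl, h6]
  have h4₂ : s₂.arr 4 = s₁.arr 4 := hF₂.arr 4 rfl
  refine Within.cond (N := q * (T * 28 + 19) + 13) (fun hx => ?_) (fun hx => ?_) le_rfl
  · have hit : i < t₀ := by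
      by_contra h
      exact hx (by rw [h24, if_neg h])
    refine within_straight rfl (by simp [Cmd.steps]) ?_
    change (∀ j < i + 1, s₂.arr 4 j = Y j) ∧ ∀ j < t₀, s₂.arr 4 j = Y j
    rw [h4₂]
    exact ⟨fun j hj => hguess j (by omega), hguess⟩
  · have hit : ¬ i < t₀ := by
      intro h
      rw [h24, if_pos h] at hx
      exact one_ne_zero hx
    refine Within.seq (Q := fun s' => s'.reg 11 = U i) (within_straight rfl le_rfl ?_)
      (fun s₃ hF₃ h11 => ?_) (M := q * (T * 28 + 19) + 11) (by simp [Cmd.steps]; omega)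
    · simp [Cmd.effect, Store.setReg, hF₂.arr 2 rfl, hF₁.arr 2 rfl, hF₂.reg 17 rfl, hi₁, hU i hi]
    have h17 : s₃.reg 17 = i := by rw [hF₃.reg 17 rfl, hF₂.reg 17 rfl, hi₁]
    have hmono : q * (i * 28 + 19) ≤ q * (T * 28 + 19) := by gcongr
    refine Within.seq (within_reply ((hE₁.of_frame hF₂ rfl).of_frame hF₃ rfl) (v := U i)
      (len := i) hb hqb (by omega) h11 h17 (U := U) (L := Y) ?_ ?_) (fun s₄ hF₄ h18 => ?_)
      (M := 1) (by omega)
    · intro j hj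
      rw [hF₃.arr 2 rfl, hF₂.arr 2 rfl, hF₁.arr 2 rfl, hU j (by omega)]
    · intro j hj
      rw [hF₃.arr 4 rfl, h4₂, hlow j hj]
    refine within_straight rfl le_rfl ?_
    have h4₄ : s₄.arr 4 = s₁.arr 4 := by rw [hF₄.arr 4 rfl, hF₃.arr 4 rfl, h4₂]
    have h17₄ : s₄.reg 17 = i := (hF₄.reg 17 rfl).trans h17
    constructor
    · intro j hj
      rcases Nat.lt_succ_iff_lt_or_eq.1 hj with hj | rfl
      · simp [Cmd.effect, Store.setArr, h17₄, hj.ne, h4₄, hlow j hj]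
      · have h := hYval j hi
        rw [if_neg hit] at h
        simp [Cmd.effect, Store.setArr, h17₄, h18, ← h]
    · intro j hj
      have : j ≠ i := by omega
      simp [Cmd.effect, Store.setArr, h17₄, this, h4₄, hguess j hj]

theorem sampleReply_congr_guess [NeZero q] (I : Instance n q) {d d' : ℕ → Fin q} {t₀ T : ℕ}
    (h : ∀ i < t₀, d i = d' i) (U : ℕ → Fin n) (r : Fin n → ℕ) :
    I.sampleReply d t₀ T U r = I.sampleReply d' t₀ T U r := by
  funext v
  rw [Instance.sampleReply, Instance.sampleReply,
    I.sampleLabels_congr (fun j hj => h j (by omega)) (fun _ _ => rfl)]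

theorem within_sample [NeZero n] [NeZero q] (hE : Env I s) (hb : n * n * q + 2 < 2 ^ b)
    (hqb : q < 2 ^ b) {t₀ T : ℕ} (ht₀T : t₀ ≤ T) (hT : T + 1 < 2 ^ b) (h6 : s.reg 6 = t₀)
    (h7 : s.reg 7 = T) {U : ℕ → Fin n} (hU : ∀ j < T, s.arr 2 j = U j) {r : Fin n → ℕ}
    (hr : ∀ v, r v ≤ T) (h3 : ∀ v : Fin n, s.arr 3 v = r v) (h4 : ∀ j, s.arr 4 j = 0)
    (hbest : HasBest I s) :
    Within b sampleCmd s (q ^ t₀ * (T * (q * (T * 28 + 19) + 21) +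
        n * (q * (T * 28 + 19) + 18) + n * (n * 26 + 20) + t₀ * 16 + 41) + 3)
      (fun s' => HasBest I s' ∧ s'.reg 10 ≤ s.reg 10 ∧
        ∀ d, s'.reg 10 ≤ I.cost (I.sampleReply d t₀ T U r)) := by
  have hq : 1 ≤ q := Nat.pos_of_ne_zero (NeZero.ne q)
  have hnb : n + 1 < 2 ^ b := by
    have h1 : n ≤ n * n := Nat.le_mul_self n
    have h2 : n * n ≤ n * n * q := Nat.le_mul_of_pos_right _ hq
    omega
  have hb1 : 1 % 2 ^ b = 1 := Nat.mod_eq_of_lt (by omega)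
  refine Within.seq (Q := fun s' => s'.reg 32 = 1) (within_straight rfl le_rfl ?_)
    (fun s₁ hF₁ h32 => ?_) (M := q ^ t₀ * (T * (q * (T * 28 + 19) + 21) +
        n * (q * (T * 28 + 19) + 18) + n * (n * 26 + 20) + t₀ * 16 + 41) + 1)
    (by simp [Cmd.steps]; omega)
  · simp [Cmd.effect, Store.setReg, hb1]
  have hE₁ := hE.of_frame hF₁ rfl
  refine (within_loop (N := q ^ t₀) (B := T * (q * (T * 28 + 19) + 21) +
        n * (q * (T * 28 + 19) + 18) + n * (n * 26 + 20) + t₀ * 16 + 40)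
    (fun N s' => (s'.reg 32 = if N < q ^ t₀ then 1 else 0) ∧
      (∀ i < t₀, s'.arr 4 i = guess q N i) ∧ HasBest I s' ∧ s'.reg 10 ≤ s.reg 10 ∧
      ∀ N' < N, s'.reg 10 ≤ I.cost (I.sampleReply (guess q N') t₀ T U r)) ?_ ?_ ?_).conseq ?_ le_rfl
  · refine ⟨by rw [h32, if_pos (by positivity)], fun i hi => ?_,
      hbest.congr (hF₁.arr 1 rfl) (hF₁.reg 10 rfl), (hF₁.reg 10 rfl).le, by omega⟩
    rw [hF₁.arr 4 rfl, h4]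
    simp [guess]
  · rintro N hN s₂ hF₂ ⟨h32₂, hdig, hbest₂, h10₂, hall⟩
    refine ⟨by rw [h32₂, if_pos hN]; exact one_ne_zero, ?_⟩
    have hE₂ := hE₁.of_frame hF₂ rfl
    have h6₂ : s₂.reg 6 = t₀ := by rw [hF₂.reg 6 rfl, hF₁.reg 6 rfl, h6]
    refine Within.seq (within_label hE₂ hb hqb ht₀T hT h6₂
      (by rw [hF₂.reg 7 rfl, hF₁.reg 7 rfl, h7]) (U := U)
      (fun j hj => by rw [hF₂.arr 2 rfl, hF₁.arr 2 rfl, hU j hj]) hdig) (fun s₃ hF₃ hY => ?_)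
      (M := n * (q * (T * 28 + 19) + 18) + n * (n * 26 + 20) + t₀ * 16 + 34) (by omega)
    have hE₃ := hE₂.of_frame hF₃ rfl
    have hz : Within b (forTo 11 0 25 (.seq (.load 17 3 11)
        (.seq (replyCmd 2 4) (.write 5 11 18)))) s₃ (n * (q * (T * 28 + 19) + 18) + 5)
        (fun s' => ∀ v : Fin n, s'.arr 5 v = I.sampleReply (guess q N) t₀ T U r v) := by
      refine (within_forTo (N := n) (B := q * (T * 28 + 19) + 13)
        (L := n * (q * (T * 28 + 19) + 18) + 5)
        (fun i s' => ∀ v : Fin n, (v : ℕ) < i →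
          s'.arr 5 v = I.sampleReply (guess q N) t₀ T U r v)
        hE₃.n hE₃.one (by omega) rfl rfl (fun j s' w w' h => h) (fun v hv => by omega) ?_
        (le_of_eq (by ring))).conseq (fun s' _ h v => h v v.2) le_rfl
      intro j hj s₄ hF₄ hj₄ hJ₄
      set v : Fin n := ⟨j, hj⟩ with hv
      have h3₄ : s₄.arr 3 j = r v := by
        rw [hF₄.arr 3 rfl, hF₃.arr 3 rfl, hF₂.arr 3 rfl, hF₁.arr 3 rfl]
        exact h3 v
      refine Within.seq (Q := fun s' => s'.reg 17 = r v) (within_straight rfl le_rfl ?_)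
        (fun s₅ hF₅ h17 => ?_) (M := q * (T * 28 + 19) + 11) (by simp [Cmd.steps]; omega)
      · simp [Cmd.effect, Store.setReg, hj₄, h3₄]
      have hrT := hr v
      have hmono : q * (r v * 28 + 19) ≤ q * (T * 28 + 19) := by gcongr
      have h11 : s₅.reg 11 = j := (hF₅.reg 11 rfl).trans hj₄
      refine Within.seq (within_reply ((hE₃.of_frame hF₄ rfl).of_frame hF₅ rfl) (v := v)
        (len := r v) hb hqb (by omega) h11 h17 (U := U)
        (L := I.sampleLabels (guess q N) t₀ U T) ?_ ?_) (fun s₆ hF₆ h18 => ?_) (M := 1) (by omega)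
      · intro i hi
        rw [hF₅.arr 2 rfl, hF₄.arr 2 rfl, hF₃.arr 2 rfl, hF₂.arr 2 rfl, hF₁.arr 2 rfl,
          hU i (by omega)]
      · intro i hi
        rw [hF₅.arr 4 rfl, hF₄.arr 4 rfl, hY i (by omega)]
      refine within_straight rfl le_rfl ?_
      have h11₆ : s₆.reg 11 = j := (hF₆.reg 11 rfl).trans h11
      have h5₆ : s₆.arr 5 = s₄.arr 5 := (hF₆.arr 5 rfl).trans (hF₅.arr 5 rfl)
      intro w hw
      rcases Nat.lt_succ_iff_lt_or_eq.1 hw with hw | hw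
      · simp [Cmd.effect, Store.setArr, h11₆, hw.ne, h5₆, hJ₄ w hw]
      · have : w = v := Fin.ext hw
        simp [Cmd.effect, Store.setArr, h11₆, this, hv, h18, Instance.sampleReply]
    refine Within.seq hz (fun s₄ hF₄ h5 => ?_)
      (M := n * (n * 26 + 20) + t₀ * 16 + 28) (by omega)
    have hE₄ := hE₃.of_frame hF₄ rfl
    have e10 : s₄.reg 10 = s₂.reg 10 := (hF₄.reg 10 rfl).trans (hF₃.reg 10 rfl)
    have e1 : s₄.arr 1 = s₂.arr 1 := (hF₄.arr 1 rfl).trans (hF₃.arr 1 rfl)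
    refine Within.seq (within_consider hE₄ hb h5 (hbest₂.congr e1 e10)) (fun s₅ hF₅ hc => ?_)
      (M := t₀ * 16 + 9) (by omega)
    obtain ⟨hB, hle, hlez⟩ := hc
    have hE₅ := hE₄.of_frame hF₅ rfl
    refine (within_next hE₅ hqb (t₀ := t₀) (N := N) ?_ (by omega) hN ?_).conseq ?_ le_rfl
    · rw [hF₅.reg 6 rfl, hF₄.reg 6 rfl, hF₃.reg 6 rfl, h6₂]
    · intro i hi
      rw [hF₅.arr 4 rfl, hF₄.arr 4 rfl, hY i (by omega),
        I.sampleLabels_of_lt _ _ _ (Nat.lt_succ_self i) (by omega : i + 1 ≤ T),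
        Instance.sampleLabels, Function.update_self, if_pos hi]
    · rintro s₆ hF₆ ⟨hdig', h32'⟩
      have h10₆ : s₆.reg 10 = s₅.reg 10 := hF₆.reg 10 rfl
      refine ⟨h32', hdig', hB.congr (hF₆.arr 1 rfl) h10₆, by omega, fun N' hN' => ?_⟩
      rcases Nat.lt_succ_iff_lt_or_eq.1 hN' with h | rfl
      · have := hall N' h
        omega
      · omega
  · rintro s' ⟨h, -⟩
    simpa using h
  · rintro s' - ⟨-, -, hB, hle, hall⟩
    refine ⟨hB, hle, fun d => ?_⟩
    obtain ⟨N, hN, hNd⟩ := exists_guess_eq d t₀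
    rw [← sampleReply_congr_guess I hNd]
    exact hall N hN

end

/-! ### Random choices and the initial computation -/

/-- Independent uniform choices amount to a uniform choice of a pair. -/
theorem uniform_bind_bind {A B C D : Type*} [Fintype A] [Nonempty A] [Fintype B] [Nonempty B]
    [Fintype C] [Nonempty C] (e : A × B ≃ C) (f : C → PMF D) :
    ((PMF.uniformOfFintype A).bind fun x => (PMF.uniformOfFintype B).bind fun y => f (e (x, y))) =
      (PMF.uniformOfFintype C).bind f := by
  ext d
  have hcard : (Fintype.card C : ENNReal)⁻¹ = (Fintype.card A : ENNReal)⁻¹ *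
      (Fintype.card B : ENNReal)⁻¹ := by
    rw [← Fintype.card_congr e, Fintype.card_prod, Nat.cast_mul,
      ENNReal.mul_inv (Or.inr (ENNReal.natCast_ne_top _)) (Or.inl (ENNReal.natCast_ne_top _))]
  simp only [PMF.bind_apply, PMF.uniformOfFintype_apply, tsum_fintype]
  rw [← e.sum_comp, Fintype.sum_prod_type, hcard]
  simp only [Finset.mul_sum, mul_assoc]

theorem uniformOfFinset_range_bind {D : Type*} (M : ℕ) (h : (Finset.range (M + 1)).Nonempty)
    (f : ℕ → PMF D) : (PMF.uniformOfFinset (Finset.range (M + 1)) h).bind f =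
      (PMF.uniformOfFintype (Fin (M + 1))).bind fun i => f i := by
  ext d
  simp only [PMF.bind_apply, PMF.uniformOfFintype_apply, tsum_fintype, PMF.uniformOfFinset_apply,
    Finset.card_range, Fintype.card_fin]
  rw [tsum_eq_sum (s := Finset.range (M + 1)) (fun i hi => by rw [if_neg hi, zero_mul]),
    Finset.sum_range]
  refine Finset.sum_congr rfl fun i _ => ?_
  rw [if_pos (Finset.mem_range.2 i.2)]

/-- Fill array `a` with as many uniformly random numbers from `0` to the content of register `y`
as register `m` says. -/
def fillCmd (a m y : ℕ) : Cmd := forTo 11 m 25 (.seq (.rand 12 y) (.write a 11 12))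

/-- The last `r` iterations of the loop of `fillCmd`: the store that results is a function of `r`
independent uniform numbers. -/
theorem run_fill_loop {b a m y : ℕ} (hm : m < 11) (hy : y < 11) {N M : ℕ} (hN : N < 2 ^ b)
    (r i : ℕ) (hir : i + r = N) (s : Store) (h11 : s.reg 11 = i) (hmN : s.reg m = N)
    (h3 : s.reg 3 = 1) (hyM : s.reg y = M) (h25 : s.reg 25 = if i < N then 1 else 0) :
    ∃ S : (Fin r → Fin (M + 1)) → Store,
      (∀ K t, run b (t + (r * 8 + 1)) (.loop 25 (.seq (.seq (.rand 12 y) (.write a 11 12))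
          (.seq (.op .add 11 11 3) (.op .lt 25 11 m))) :: K, s) =
        (PMF.uniformOfFintype (Fin r → Fin (M + 1))).bind fun g => run b t (K, S g)) ∧
      ∀ g, (∀ x < 11, (S g).reg x = s.reg x) ∧ (∀ a' ≠ a, (S g).arr a' = s.arr a') ∧
        (∀ j < i, (S g).arr a j = s.arr a j) ∧ ∀ j : Fin r, (S g).arr a (i + j) = g j := by
  induction r generalizing i s with
  | zero =>
    refine ⟨fun _ => s, fun K t => ?_, fun g => ⟨fun _ _ => rfl, fun _ _ => rfl, fun _ _ => rfl,
      fun j => j.elim0⟩⟩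
    have h0 : s.reg 25 = 0 := by rw [h25, if_neg (by omega)]
    rw [PMF.bind_const]
    exact run_succ_of_step (by rw [step, if_neg (not_not.2 h0)]) t
  | succ r ih =>
    have h1 : s.reg 25 ≠ 0 := by
      rw [h25, if_pos (by omega)]
      exact one_ne_zero
    -- the memory after one iteration in which `w` was drawn
    set s' : ℕ → Store := fun w =>
      (((s.setReg 12 w).setArr a i w).setReg 11 (i + 1)).setReg 25
        (if i + 1 < N then 1 else 0) with hs'
    have hlow : ∀ w, ∀ x < 11, (s' w).reg x = s.reg x := by
      intro w x hx
      simp [hs', Store.setReg, Store.setArr, Function.update_of_ne (show x ≠ 25 by omega),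
        Function.update_of_ne (show x ≠ 11 by omega),
        Function.update_of_ne (show x ≠ 12 by omega)]
    have hiter : ∀ K t, run b (t + 8) (.loop 25 (.seq (.seq (.rand 12 y) (.write a 11 12))
          (.seq (.op .add 11 11 3) (.op .lt 25 11 m))) :: K, s) =
        (PMF.uniformOfFintype (Fin (M + 1))).bind fun w : Fin (M + 1) =>
          run b t (.loop 25 (.seq (.seq (.rand 12 y) (.write a 11 12))
          (.seq (.op .add 11 11 3) (.op .lt 25 11 m))) :: K, s' w) := by
      intro K t
      subst hyM
      rw [run_succ_of_step (by rw [step, if_pos h1]) (t + 7),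
        run_succ_of_step (by rw [step]) (t + 6), run_succ_of_step (by rw [step]) (t + 5), run,
        step, PMF.bind_map]
      refine (uniformOfFinset_range_bind _ _ _).trans ?_
      congr 1
      funext w
      simp only [Function.comp]
      rw [run_succ_of_step (by rw [step]) (t + 3), run_succ_of_step (by rw [step]) (t + 2),
        run_succ_of_step (by rw [step]) (t + 1), run_succ_of_step (by rw [step]) t]
      congr 2
      have e : (i + 1) % 2 ^ b = i + 1 := Nat.mod_eq_of_lt (by omega)
      simp [hs', Store.setReg, Store.setArr, BinOp.eval, h11, h3, e,
        Function.update_of_ne (show m ≠ 11 by omega),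
        Function.update_of_ne (show m ≠ 12 by omega), hmN]
    have hIH : ∀ w : Fin (M + 1), _ := fun w => ih (i + 1) (by omega) (s' w)
      (by simp [hs', Store.setReg]) ((hlow w m hm).trans hmN) ((hlow w 3 (by norm_num)).trans h3)
      ((hlow w y hy).trans hyM) (by simp [hs', Store.setReg])
    choose S hS hS' using hIH
    refine ⟨fun g => S (g 0) (Fin.tail g), fun K t => ?_, fun g => ?_⟩
    · rw [show t + ((r + 1) * 8 + 1) = (t + (r * 8 + 1)) + 8 by ring, hiter]
      rw [← uniform_bind_bind (Fin.consEquiv fun _ : Fin (r + 1) => Fin (M + 1))]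
      congr 1
      funext w
      rw [hS w K t]
      rfl
    · obtain ⟨hr, ha, hl, hg⟩ := hS' (g 0) (Fin.tail g)
      have hai : ∀ j, (s' (g 0)).arr a j = if j = i then ((g 0 : Fin (M + 1)) : ℕ)
          else s.arr a j := by
        intro j
        simp [hs', Store.setReg, Store.setArr, Function.update_apply]
      refine ⟨fun x hx => (hr x hx).trans (hlow _ x hx), fun a' ha' => ?_, fun j hj => ?_, ?_⟩
      · rw [ha a' ha']
        simp [hs', Store.setReg, Store.setArr, Function.update_of_ne ha']
      · rw [hl j (by omega), hai, if_neg hj.ne]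
      · intro j
        refine Fin.cases ?_ (fun j => ?_) j
        · rw [Fin.val_zero, add_zero, hl i (Nat.lt_succ_self i), hai, if_pos rfl]
        · have := hg j
          rw [Fin.val_succ, ← add_assoc, add_right_comm, this]
          rfl

/-- Running `fillCmd` amounts to choosing the numbers uniformly and independently. -/
theorem run_fill {b a m y : ℕ} (hm : m < 11) (hy : y < 11) {N M : ℕ} [NeZero M]
    (hN : N < 2 ^ b) (s : Store) (hmN : s.reg m = N) (h3 : s.reg 3 = 1)
    (hyM : s.reg y + 1 = M) :
    ∃ S : (Fin N → Fin M) → Store,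
      (∀ K t, run b (t + (N * 8 + 5)) (fillCmd a m y :: K, s) =
        (PMF.uniformOfFintype (Fin N → Fin M)).bind fun g => run b t (K, S g)) ∧
      ∀ g, (∀ x < 11, (S g).reg x = s.reg x) ∧ (∀ a' ≠ a, (S g).arr a' = s.arr a') ∧
        ∀ j : Fin N, (S g).arr a j = g j := by
  subst hyM
  have hm11 : m ≠ 11 := by omega
  obtain ⟨S, hS, hS'⟩ := run_fill_loop (a := a) hm hy hN N 0 (by omega)
    ((s.setReg 11 (0 % 2 ^ b)).setReg 25 (BinOp.eval b .lt ((s.setReg 11 (0 % 2 ^ b)).reg 11)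
      ((s.setReg 11 (0 % 2 ^ b)).reg m)))
    (by simp [Store.setReg])
    (by simp [Store.setReg, Function.update_of_ne (show m ≠ 25 by omega),
      Function.update_of_ne hm11, hmN])
    (by simp [Store.setReg, h3])
    (M := s.reg y) (by simp [Store.setReg, Function.update_of_ne (show y ≠ 25 by omega),
      Function.update_of_ne (show y ≠ 11 by omega)])
    (by simp [Store.setReg, BinOp.eval, Function.update_of_ne hm11, hmN])
  refine ⟨S, fun K t => ?_, fun g => ?_⟩
  · rw [← hS K t, fillCmd, forTo, show t + (N * 8 + 5) = t + (N * 8 + 1) + 4 by ring,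
      run_succ_of_step (by rw [step]) (t + (N * 8 + 1) + 3),
      run_succ_of_step (by rw [step]) (t + (N * 8 + 1) + 2),
      run_succ_of_step (by rw [step]) (t + (N * 8 + 1) + 1),
      run_succ_of_step (by rw [step]) (t + (N * 8 + 1))]
  · obtain ⟨hr, ha, -, hg⟩ := hS' g
    refine ⟨fun x hx => ?_, fun a' ha' => ?_, fun j => by simpa using hg j⟩
    · rw [hr x hx]
      simp [Store.setReg, Function.update_of_ne (show x ≠ 25 by omega),
        Function.update_of_ne (show x ≠ 11 by omega)]
    · rw [ha a' ha']
      rfl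

/-- Compute the parameters: register `5` becomes `s = 6000 q k ^ 2`, register `6` the number
`s ^ 2` of guessed labels, register `7` the size `s ^ 3` of the sample, registers `8` and `9` the
bounds for the random numbers, and register `10` an upper bound on the cost of all assignments. -/
def initCmd (q : ℕ) : Cmd :=
  .seq (.const 2 q) <| .seq (.const 3 1) <| .seq (.const 4 0) <| .seq (.const 5 (6000 * q)) <|
  .seq (.op .mul 5 5 1) <| .seq (.op .mul 5 5 1) <| .seq (.op .mul 6 5 5) <|
  .seq (.op .mul 7 6 5) <| .seq (.op .sub 8 0 3) <| .seq (.op .sub 9 7 3) (.op .mul 10 0 0)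

theorem within_init {n q k b s : ℕ} [NeZero q] (I : Instance n q) (hk : 1 ≤ k)
    (hs : s = 6000 * q * k ^ 2) (hb : n * n * q + s ^ 3 + 2 < 2 ^ b) :
    Within b (initCmd q) (input I k) 21 (fun s' => Env I s' ∧ s'.reg 6 = s ^ 2 ∧
      s'.reg 7 = s ^ 3 ∧ s'.reg 8 = n - 1 ∧ s'.reg 9 = s ^ 3 - 1 ∧ s'.reg 10 = n * n) := by
  have hq : 1 ≤ q := Nat.pos_of_ne_zero (NeZero.ne q)
  have hnq : n * n ≤ n * n * q := Nat.le_mul_of_pos_right _ hq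
  have hs1 : 1 ≤ s := by
    rw [hs]
    exact Nat.mul_pos (by omega) (by positivity)
  have h12 : s ≤ s ^ 2 := Nat.le_self_pow (by norm_num) s
  have h23 : s ^ 2 ≤ s ^ 3 := Nat.pow_le_pow_right hs1 (by norm_num)
  have hk1 : 6000 * q ≤ 6000 * q * k := Nat.le_mul_of_pos_right _ hk
  have hk2 : 6000 * q * k ≤ s := by
    rw [hs, sq, ← mul_assoc]
    exact Nat.le_mul_of_pos_right _ hk
  have e1 : q % 2 ^ b = q := Nat.mod_eq_of_lt (by omega)
  have e2 : 1 % 2 ^ b = 1 := Nat.mod_eq_of_lt (by omega)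
  have e3 : 6000 * q % 2 ^ b = 6000 * q := Nat.mod_eq_of_lt (by omega)
  have e4 : 6000 * q * k % 2 ^ b = 6000 * q * k := Nat.mod_eq_of_lt (by omega)
  have e5 : 6000 * q * k * k % 2 ^ b = s := by
    rw [hs, mul_assoc (6000 * q) k k, ← sq, ← hs]
    exact Nat.mod_eq_of_lt (by omega)
  have e6 : s * s % 2 ^ b = s ^ 2 := by
    rw [← sq]
    exact Nat.mod_eq_of_lt (by omega)
  have e7 : s ^ 2 * s % 2 ^ b = s ^ 3 := by
    rw [show s ^ 2 * s = s ^ 3 by ring]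
    exact Nat.mod_eq_of_lt (by omega)
  have e8 : n * n % 2 ^ b = n * n := Nat.mod_eq_of_lt (by omega)
  refine within_straight rfl le_rfl ⟨⟨?_, ?_, ?_, ?_, ?_⟩, ?_, ?_, ?_, ?_, ?_⟩
  all_goals
    simp [initCmd, Cmd.effect, Store.setReg, BinOp.eval, input, e1, e2, e3, e4, e5, e6, e7, e8]

/-- Choose the sample and, for each vertex, the number of sampled vertices that it is labelled
against; then consider the candidates of all pivots and those of all guesses. -/
def program (q : ℕ) : Cmd :=
  .seq (initCmd q) <| .seq (fillCmd 2 7 8) <| .seq (fillCmd 3 0 9) <| .seq pivotCmd sampleCmd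

/-- A bound on the running time of the deterministic part of `program` on `n` vertices, for the
parameter `s`. -/
def searchTime (n q s : ℕ) : ℕ :=
  n * (q * (n * 21 + n * (q * (n * 28 + 19) + 16) + n * (n * 26 + 20) + 37) + 10) + 5 +
    (q ^ s ^ 2 * (s ^ 3 * (q * (s ^ 3 * 28 + 19) + 21) +
      n * (q * (s ^ 3 * 28 + 19) + 18) + n * (n * 26 + 20) + s ^ 2 * 16 + 41) + 3) + 1

/-- A bound on the running time of `program` on `n` vertices, for the parameter `s`. -/
def programTime (n q s : ℕ) : ℕ :=
  searchTime n q s + (n * 8 + 5) + 1 + (s ^ 3 * 8 + 5) + 1 + 21 + 1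

/-- A halted machine stays halted, so any bound on the running time will do. -/
theorem Within.run_eq {b : ℕ} {c : Cmd} {s : Store} {N : ℕ} {Q : Store → Prop}
    (h : Within b c s N Q) :
    ∃ s', Q s' ∧ ∀ M, N ≤ M → run b M ([c], s) = PMF.pure ([], s') := by
  obtain ⟨t, s', ht, he, hq⟩ := h
  refine ⟨s', hq, fun M hM => ?_⟩
  obtain ⟨r, rfl⟩ := Nat.exists_eq_add_of_le' (ht.trans hM)
  rw [he.run_eq, run_nil]

/-- The output of the program as a function of its random choices: the sample `ω.1` and the
rounding `ω.2`. -/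
theorem run_program {n q k b s : ℕ} [NeZero n] [NeZero q] [NeZero (s ^ 3)] (I : Instance n q)
    (hk : 1 ≤ k) (hs : s = 6000 * q * k ^ 2) (hb : n * n * q + s ^ 3 + 2 < 2 ^ b) :
    ∃ S : (Fin (s ^ 3) → Fin n) × (Fin n → Fin (s ^ 3)) → Store,
      run b (programTime n q s) ([program q], input I k) =
        (PMF.uniformOfFintype ((Fin (s ^ 3) → Fin n) × (Fin n → Fin (s ^ 3)))).map
          (fun ω => ([], S ω)) ∧
      ∀ ω, HasBest I (S ω) ∧ (∀ u a, (S ω).reg 10 ≤ I.cost (I.pivotReply u a)) ∧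
        ∀ d, (S ω).reg 10 ≤ I.cost (I.sampleReply d (s ^ 2) (s ^ 3) (Instance.extend ω.1)
          fun v => ω.2 v) := by
  have hn : 1 ≤ n := Nat.pos_of_ne_zero (NeZero.ne n)
  have hq : 1 ≤ q := Nat.pos_of_ne_zero (NeZero.ne q)
  have hT : 1 ≤ s ^ 3 := Nat.pos_of_ne_zero (NeZero.ne _)
  have hs1 : 1 ≤ s := by
    rw [hs]
    exact Nat.mul_pos (by omega) (by positivity)
  have h23 : s ^ 2 ≤ s ^ 3 := Nat.pow_le_pow_right hs1 (by norm_num)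
  have hqs : q ≤ n * n * q := Nat.le_mul_of_pos_left _ (by positivity)
  have hnn : n ≤ n * n * q := (Nat.le_mul_self n).trans (Nat.le_mul_of_pos_right _ hq)
  obtain ⟨t₁, s₁, ht₁, he₁, hE₁, h6, h7, h8, h9, h10⟩ := within_init I hk hs hb
  have hF₁ := he₁.frame
  obtain ⟨S₂, hS₂, hP₂⟩ := run_fill (b := b) (a := 2) (m := 7) (y := 8) (N := s ^ 3) (M := n)
    (by norm_num) (by norm_num) (by omega) s₁ h7 hE₁.one (by omega)
  have hfill : ∀ u, _ := fun u => run_fill (b := b) (a := 3) (m := 0) (y := 9) (N := n)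
    (M := s ^ 3) (by norm_num) (by norm_num) (by omega) (S₂ u)
    (((hP₂ u).1 0 (by norm_num)).trans hE₁.n) (((hP₂ u).1 3 (by norm_num)).trans hE₁.one)
    (by rw [(hP₂ u).1 9 (by norm_num), h9]; omega)
  choose S₃ hS₃ hP₃ using hfill
  have hmain : ∀ u r, Within b (.seq pivotCmd sampleCmd) (S₃ u r) (searchTime n q s)
      (fun s' => HasBest I s' ∧ (∀ u a, s'.reg 10 ≤ I.cost (I.pivotReply u a)) ∧
        ∀ d, s'.reg 10 ≤ I.cost (I.sampleReply d (s ^ 2) (s ^ 3) (Instance.extend u)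
          fun v => r v)) := by
    intro u r
    have hreg : ∀ x < 11, (S₃ u r).reg x = s₁.reg x := fun x hx =>
      ((hP₃ u r).1 x hx).trans ((hP₂ u).1 x hx)
    have harr : ∀ a, a ≠ 2 → a ≠ 3 → (S₃ u r).arr a = (input I k).arr a := fun a h2 h3 =>
      (((hP₃ u r).2.1 a h3).trans ((hP₂ u).2.1 a h2)).trans (hF₁.arr a rfl)
    have hE : Env I (S₃ u r) := ⟨(hreg 0 (by norm_num)).trans hE₁.n,
      (hreg 2 (by norm_num)).trans hE₁.q, (hreg 3 (by norm_num)).trans hE₁.one,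
      (hreg 4 (by norm_num)).trans hE₁.zero, by rw [harr 0 (by norm_num) (by norm_num)]; rfl⟩
    have hbest : HasBest I (S₃ u r) := by
      refine ⟨fun _ => 0, fun v => ?_, ?_⟩
      · rw [harr 1 (by norm_num) (by norm_num)]
        simp [input]
      · rw [hreg 10 (by norm_num), h10, ← sq]
        exact I.pairCost_le _ _
    refine Within.seq (within_pivot hE (by omega) (by omega) hbest) (fun s₄ hF₄ h₄ => ?_) le_rfl
    refine (within_sample (hE.of_frame hF₄ rfl) (by omega) (by omega) (t₀ := s ^ 2) (T := s ^ 3)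
      h23 (by omega) ?_ ?_ (U := Instance.extend u) (r := fun v => (r v : ℕ)) ?_
      (fun v => (r v).2.le) ?_ ?_ h₄.1).conseq ?_ le_rfl
    · rw [hF₄.reg 6 rfl, hreg 6 (by norm_num), h6]
    · rw [hF₄.reg 7 rfl, hreg 7 (by norm_num), h7]
    · intro j hj
      rw [hF₄.arr 2 rfl, (hP₃ u r).2.1 2 (by norm_num), (hP₂ u).2.2 ⟨j, hj⟩, Instance.extend,
        dif_pos hj]
    · intro v
      rw [hF₄.arr 3 rfl, (hP₃ u r).2.2 v]
    · intro j
      rw [hF₄.arr 4 rfl, harr 4 (by norm_num) (by norm_num)]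
      simp [input]
    · rintro s₅ - ⟨hB, hle, hd⟩
      exact ⟨hB, fun u a => hle.trans (h₄.2 u a), hd⟩
  choose S hS hrun using fun u r => (hmain u r).run_eq
  refine ⟨fun ω => S ω.1 ω.2, ?_, fun ω => hS ω.1 ω.2⟩
  set N := searchTime n q s
  obtain ⟨e, he⟩ := Nat.exists_eq_add_of_le ht₁
  have htime : programTime n q s =
      (e + N) + (n * 8 + 5) + 1 + (s ^ 3 * 8 + 5) + 1 + t₁ + 1 := by
    rw [programTime, he]
    ring
  rw [htime, program, run_succ_of_step (by rw [step]), he₁.run_eq,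
    run_succ_of_step (by rw [step]), hS₂]
  have hround : ∀ u, run b ((e + N) + (n * 8 + 5) + 1)
      ([.seq (fillCmd 3 0 9) (.seq pivotCmd sampleCmd)], S₂ u) =
      (PMF.uniformOfFintype (Fin n → Fin (s ^ 3))).bind fun r => PMF.pure ([], S u r) := by
    intro u
    rw [run_succ_of_step (by rw [step]), hS₃]
    congr 1
    funext r
    exact hrun u r (e + N) (Nat.le_add_left _ _)
  simp only [hround]
  exact uniform_bind_bind (Equiv.refl _) fun ω : (Fin (s ^ 3) → Fin n) × (Fin n → Fin (s ^ 3)) =>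
    PMF.pure (([], S ω.1 ω.2) : Config)

/-! ### The bounds on running time and word size -/

/-- For `n` vertices the candidates of the pivots cost `O(n ^ 3)`, and those of the guesses `n ^ 2`
times a number that depends on `q` and `s` only. -/
theorem programTime_le (n q s : ℕ) (hn : 1 ≤ n) (hq : 1 ≤ q) (hs : 1 ≤ s) :
    programTime n q s ≤ 400 * q ^ 2 * n ^ 3 + n ^ 2 * (q ^ s ^ 2 * (400 * q * s ^ 6)) := by
  set T := s ^ 3 with hT
  set G := q ^ s ^ 2 with hG
  have hT1 : 1 ≤ T := Nat.one_le_pow _ _ hs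
  have hG1 : 1 ≤ G := Nat.one_le_pow _ _ hq
  have hsT : s ^ 2 ≤ T := Nat.pow_le_pow_right hs (by norm_num)
  set X := n ^ 2 * T ^ 2 * q with hX
  set Z := q ^ 2 * n ^ 3 with hZ
  have hXpos : 0 < X := by positivity
  have hZpos : 0 < Z := by positivity
  have HX : ∀ a c, a * c = X → a ≤ X := fun a c h => Nat.le_of_dvd hXpos ⟨c, h.symm⟩
  have HZ : ∀ a c, a * c = Z → a ≤ Z := fun a c h => Nat.le_of_dvd hZpos ⟨c, h.symm⟩
  have hbr : T * (q * (T * 28 + 19) + 21) + n * (q * (T * 28 + 19) + 18) + n * (n * 26 + 20) +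
      s ^ 2 * 16 + 41 ≤ 300 * X := by
    have x1 := HX (T * q * T) (n ^ 2) (by ring)
    have x2 := HX (T * q) (n ^ 2 * T) (by ring)
    have x3 := HX T (n ^ 2 * T * q) (by ring)
    have x4 := HX (n * q * T) (n * T) (by ring)
    have x5 := HX (n * q) (n * T ^ 2) (by ring)
    have x6 := HX n (n * T ^ 2 * q) (by ring)
    have x7 := HX (n * n) (T ^ 2 * q) (by ring)
    have e : T * (q * (T * 28 + 19) + 21) + n * (q * (T * 28 + 19) + 18) + n * (n * 26 + 20) =
      28 * (T * q * T) + 19 * (T * q) + 21 * T + 28 * (n * q * T) + 19 * (n * q) + 38 * n +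
        26 * (n * n) := by ring
    rw [e]
    omega
  have hTX : T ≤ G * X := (HX T (n ^ 2 * T * q) (by ring)).trans (Nat.le_mul_of_pos_left _ hG1)
  have hGX : G * (T * (q * (T * 28 + 19) + 21) + n * (q * (T * 28 + 19) + 18) +
      n * (n * 26 + 20) + s ^ 2 * 16 + 41) ≤ 300 * (G * X) := by
    calc _ ≤ G * (300 * X) := Nat.mul_le_mul_left _ hbr
      _ = 300 * (G * X) := by ring
  have hpiv : n * (q * (n * 21 + n * (q * (n * 28 + 19) + 16) + n * (n * 26 + 20) + 37) + 10) ≤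
      200 * Z := by
    have z1 := HZ (n * q * n) (n * q) (by ring)
    have z2 := HZ (n * q * n * q * n) 1 (by ring)
    have z3 := HZ (n * q * n * q) n (by ring)
    have z4 := HZ (n * q * n * n) q (by ring)
    have z5 := HZ (n * q) (n ^ 2 * q) (by ring)
    have z6 := HZ n (n ^ 2 * q ^ 2) (by ring)
    have e : n * (q * (n * 21 + n * (q * (n * 28 + 19) + 16) + n * (n * 26 + 20) + 37) + 10) =
      57 * (n * q * n) + 28 * (n * q * n * q * n) + 19 * (n * q * n * q) + 26 * (n * q * n * n) +
        37 * (n * q) + 10 * n := by ring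
    rw [e]
    omega
  have hnZ := HZ n (n ^ 2 * q ^ 2) (by ring)
  have hfin : 400 * q ^ 2 * n ^ 3 + n ^ 2 * (G * (400 * q * s ^ 6)) = 400 * Z + 400 * (G * X) := by
    rw [hZ, hX, hT]
    ring
  rw [hfin, programTime, searchTime, ← hT, ← hG]
  omega

theorem programTime_le_two_pow (n q k s : ℕ) (hn : 1 ≤ n) (hq : 1 ≤ q) (hk : 1 ≤ k)
    (hs : s = 6000 * q * k ^ 2) :
    programTime n q s ≤ (400 * q ^ 2 + 1) * n ^ 3 +
      2 ^ (3 * (36000000 * q ^ 3 + 36400 * q) * k ^ 4) := by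
  have hs1 : 1 ≤ s := by
    rw [hs]
    exact Nat.mul_pos (by omega) (by positivity)
  set Y := q ^ s ^ 2 * (400 * q * s ^ 6) with hY
  have hY2 : Y ≤ 2 ^ (q * s ^ 2 + (400 * q + s * 6)) := by
    rw [pow_add, pow_add, pow_mul 2 q, pow_mul 2 s 6]
    have h1 : q ≤ 2 ^ q := Nat.lt_two_pow_self.le
    have h2 : 400 * q ≤ 2 ^ (400 * q) := Nat.lt_two_pow_self.le
    have h3 : s ≤ 2 ^ s := Nat.lt_two_pow_self.le
    exact Nat.mul_le_mul (Nat.pow_le_pow_left h1 _)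
      (Nat.mul_le_mul h2 (Nat.pow_le_pow_left h3 _))
  have hexp : (q * s ^ 2 + (400 * q + s * 6)) * 3 ≤
      3 * (36000000 * q ^ 3 + 36400 * q) * k ^ 4 := by
    have h4 : 1 ≤ k ^ 4 := Nat.one_le_pow _ _ hk
    have h24 : k ^ 2 ≤ k ^ 4 := Nat.pow_le_pow_right hk (by norm_num)
    have a1 : q ≤ q * k ^ 4 := Nat.le_mul_of_pos_right _ h4
    have a2 : q * k ^ 2 ≤ q * k ^ 4 := Nat.mul_le_mul_left _ h24
    have e1 : q * s ^ 2 = 36000000 * (q ^ 3 * k ^ 4) := by rw [hs]; ring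
    have e2 : s = 6000 * (q * k ^ 2) := by rw [hs]; ring
    have e3 : 3 * (36000000 * q ^ 3 + 36400 * q) * k ^ 4 =
      108000000 * (q ^ 3 * k ^ 4) + 109200 * (q * k ^ 4) := by ring
    rw [e1, e3]
    omega
  have hY3 : Y ^ 3 ≤ 2 ^ (3 * (36000000 * q ^ 3 + 36400 * q) * k ^ 4) :=
    calc Y ^ 3 ≤ (2 ^ (q * s ^ 2 + (400 * q + s * 6))) ^ 3 := Nat.pow_le_pow_left hY2 3
      _ = 2 ^ ((q * s ^ 2 + (400 * q + s * 6)) * 3) := (pow_mul _ _ _).symm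
      _ ≤ _ := Nat.pow_le_pow_right (by norm_num) hexp
  -- either `Y ≤ n`, or `n ^ 2 * Y ≤ Y ^ 3`
  have hnY : n ^ 2 * Y ≤ n ^ 3 + Y ^ 3 := by
    rcases le_total Y n with h | h
    · calc n ^ 2 * Y ≤ n ^ 2 * n := Nat.mul_le_mul_left _ h
        _ = n ^ 3 := by ring
        _ ≤ _ := Nat.le_add_right _ _
    · calc n ^ 2 * Y ≤ Y ^ 2 * Y := Nat.mul_le_mul_right _ (Nat.pow_le_pow_left h 2)
        _ = Y ^ 3 := by ring
        _ ≤ _ := Nat.le_add_left _ _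
  calc programTime n q s ≤ 400 * q ^ 2 * n ^ 3 + n ^ 2 * Y := programTime_le n q s hn hq hs1
    _ ≤ 400 * q ^ 2 * n ^ 3 + (n ^ 3 + Y ^ 3) := Nat.add_le_add_left hnY _
    _ = (400 * q ^ 2 + 1) * n ^ 3 + Y ^ 3 := by ring
    _ ≤ _ := Nat.add_le_add_left hY3 _

theorem programTime_le_rpow (n q s : ℕ) (hn : 1 ≤ n) (hq : 1 ≤ q) (τ : ℝ) (hτ : 0 < τ)
    (hs : s = 6000 * q * ⌈1 / τ⌉₊ ^ 2) {E C : ℕ} (hE : E = 3 * (36000000 * q ^ 3 + 36400 * q))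
    (hC : C = 400 * q ^ 2 + 1 + 2 ^ E + 16 * E) :
    (programTime n q s : ℝ) ≤ C * (n : ℝ) ^ 3 + (2 : ℝ) ^ ((C : ℝ) / τ ^ 4) := by
  set k := ⌈1 / τ⌉₊ with hk
  have hk1 : 1 ≤ k := Nat.ceil_pos.2 (by positivity)
  have h := programTime_le_two_pow n q k s hn hq hk1 hs
  rw [← hE] at h
  have hR : (programTime n q s : ℝ) ≤ (400 * (q : ℝ) ^ 2 + 1) * (n : ℝ) ^ 3 + 2 ^ (E * k ^ 4) := by
    exact_mod_cast h
  refine hR.trans ?_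
  have hn3 : (1 : ℝ) ≤ (n : ℝ) ^ 3 := one_le_pow₀ (by exact_mod_cast hn)
  have hCR : (C : ℝ) = 400 * (q : ℝ) ^ 2 + 1 + 2 ^ E + 16 * E := by
    rw [hC]
    push_cast
    ring
  have hE0 : (0 : ℝ) ≤ E := Nat.cast_nonneg E
  have h2E : (0 : ℝ) ≤ 2 ^ E := by positivity
  rcases le_or_gt τ 1 with h1 | h1
  · -- here `k ≤ 2 / τ`
    have hkτ : (k : ℝ) ≤ 2 / τ := by
      have h2 : (k : ℝ) < 1 / τ + 1 := Nat.ceil_lt_add_one (by positivity)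
      have h3 : 1 ≤ 1 / τ := (one_le_div hτ).2 h1
      have h4 : 2 / τ = 1 / τ + 1 / τ := by ring
      linarith
    have hexp : (E : ℝ) * (k : ℝ) ^ 4 ≤ (C : ℝ) / τ ^ 4 := by
      calc (E : ℝ) * (k : ℝ) ^ 4 ≤ E * (2 / τ) ^ 4 := by gcongr
        _ = 16 * E / τ ^ 4 := by ring
        _ ≤ C / τ ^ 4 := by
          gcongr
          rw [hCR]
          linarith [sq_nonneg (q : ℝ)]
    have hpow : (2 : ℝ) ^ (E * k ^ 4) ≤ (2 : ℝ) ^ ((C : ℝ) / τ ^ 4) := by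
      rw [← Real.rpow_natCast]
      apply Real.rpow_le_rpow_of_exponent_le (by norm_num)
      push_cast
      exact hexp
    have : (400 * (q : ℝ) ^ 2 + 1) * (n : ℝ) ^ 3 ≤ C * (n : ℝ) ^ 3 := by
      gcongr
      rw [hCR]
      linarith
    linarith
  · -- here `k = 1`
    have hk2 : k = 1 := by
      refine le_antisymm (Nat.ceil_le.2 ?_) hk1
      rw [Nat.cast_one]
      exact (div_le_one hτ).2 h1.le
    rw [hk2, one_pow, mul_one]
    have h3 : (2 : ℝ) ^ E ≤ 2 ^ E * (n : ℝ) ^ 3 := le_mul_of_one_le_right h2E hn3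
    have h4 : (0 : ℝ) ≤ (2 : ℝ) ^ ((C : ℝ) / τ ^ 4) := by positivity
    have h5 : (0 : ℝ) ≤ 16 * E * (n : ℝ) ^ 3 := by positivity
    have h6 : (C : ℝ) * (n : ℝ) ^ 3 = (400 * (q : ℝ) ^ 2 + 1) * (n : ℝ) ^ 3 +
        2 ^ E * (n : ℝ) ^ 3 + 16 * E * (n : ℝ) ^ 3 := by
      rw [hCR]
      ring
    linarith

/-- Words of the given length hold all numbers that the program computes. -/
theorem word_size (n q k s : ℕ) (hn : 1 ≤ n) (hk : 1 ≤ k) (hs : s = 6000 * q * k ^ 2) {c : ℕ}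
    (hc : c = 6 + (q + (6000 * q) ^ 3 + 2)) :
    n * n * q + s ^ 3 + 2 < 2 ^ (c * (Nat.log 2 (n + k) + 1)) := by
  set W := 2 ^ (Nat.log 2 (n + k) + 1) with hW
  have hlt : n + k < W := Nat.lt_pow_succ_log_self (by norm_num) _
  have hW2 : 2 ≤ W := by omega
  have hpow : 2 ^ (c * (Nat.log 2 (n + k) + 1)) = W ^ 6 * W ^ (q + (6000 * q) ^ 3 + 2) := by
    rw [mul_comm c, pow_mul, ← hW, hc, pow_add]
  have hnW : n * n ≤ W ^ 6 :=
    calc n * n = n ^ 2 := (sq n).symm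
      _ ≤ W ^ 2 := Nat.pow_le_pow_left (by omega) 2
      _ ≤ W ^ 6 := Nat.pow_le_pow_right (by omega) (by norm_num)
  have hsW : s ^ 3 ≤ W ^ 6 * (6000 * q) ^ 3 :=
    calc s ^ 3 = k ^ 6 * (6000 * q) ^ 3 := by rw [hs]; ring
      _ ≤ W ^ 6 * (6000 * q) ^ 3 := Nat.mul_le_mul_right _ (Nat.pow_le_pow_left (by omega) 6)
  have h1 : 1 ≤ W ^ 6 := Nat.one_le_pow _ _ (by omega)
  rw [hpow]
  calc n * n * q + s ^ 3 + 2 ≤ W ^ 6 * q + W ^ 6 * (6000 * q) ^ 3 + W ^ 6 * 2 :=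
        Nat.add_le_add (Nat.add_le_add (Nat.mul_le_mul_right _ hnW) hsW) (by omega)
    _ = W ^ 6 * (q + (6000 * q) ^ 3 + 2) := by ring
    _ < W ^ 6 * 2 ^ (q + (6000 * q) ^ 3 + 2) :=
        Nat.mul_lt_mul_of_pos_left Nat.lt_two_pow_self h1
    _ ≤ _ := Nat.mul_le_mul_left _ (Nat.pow_le_pow_left hW2 _)

end UGFull

/-- For every number `q` of labels there are one program `P` and constants `C`, `c` such that,
for all `τ > 0`, on every instance with `n` vertices (and on `⌈1 / τ⌉`), run with words of
`c * (⌊log₂ (n + ⌈1 / τ⌉)⌋ + 1)` bits, `P` always halts with an assignment within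
`C * n ^ 3 + 2 ^ (C / τ ^ 4)` steps, and with probability at least `2 / 3` the number of edges
violated by this assignment is at most `1 + τ` times the optimum. -/
theorem theorem6 (q : ℕ) (hq : 1 ≤ q) :
    ∃ (P : UGFull.Cmd) (C c : ℕ), ∀ τ : ℝ, 0 < τ →
      ∀ n : ℕ, 1 ≤ n → ∀ I : UGFull.Instance n q,
        ∃ T : ℕ, (T : ℝ) ≤ C * (n : ℝ) ^ 3 + (2 : ℝ) ^ ((C : ℝ) / τ ^ 4) ∧
          (∀ F ∈ (UGFull.run (c * (Nat.log 2 (n + ⌈1 / τ⌉₊) + 1)) T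
              ([P], UGFull.input I ⌈1 / τ⌉₊)).support,
            ∃ x : Fin n → Fin q, UGFull.Outputs F x) ∧
          2 / 3 ≤ (UGFull.run (c * (Nat.log 2 (n + ⌈1 / τ⌉₊) + 1)) T
              ([P], UGFull.input I ⌈1 / τ⌉₊)).toOuterMeasure
            {F | ∃ x : Fin n → Fin q, UGFull.Outputs F x ∧
              ((I.violated x).card : ℝ) ≤ (1 + τ) * (I.opt : ℝ)} := by
  have hq0 : NeZero q := ⟨by omega⟩
  obtain ⟨E, hE⟩ : ∃ E, E = 3 * (36000000 * q ^ 3 + 36400 * q) := ⟨_, rfl⟩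
  obtain ⟨C, hC⟩ : ∃ C, C = 400 * q ^ 2 + 1 + 2 ^ E + 16 * E := ⟨_, rfl⟩
  obtain ⟨c, hc⟩ : ∃ c, c = 6 + (q + (6000 * q) ^ 3 + 2) := ⟨_, rfl⟩
  refine ⟨UGFull.program q, C, c, fun τ hτ n hn I => ⟨UGFull.programTime n q
    (6000 * q * ⌈1 / τ⌉₊ ^ 2), UGFull.programTime_le_rpow n q _ hn hq τ hτ rfl hE hC, ?_⟩⟩
  have hn0 : NeZero n := ⟨by omega⟩
  set k := ⌈1 / τ⌉₊ with hk
  have hk1 : 1 ≤ k := Nat.ceil_pos.2 (by positivity)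
  obtain ⟨s, hs⟩ : ∃ s, s = 6000 * q * k ^ 2 := ⟨_, rfl⟩
  have hs1 : 1 ≤ s := by
    rw [hs]
    exact Nat.mul_pos (by omega) (by positivity)
  have hT0 : NeZero (s ^ 3) := ⟨by positivity⟩
  rw [← hs]
  obtain ⟨S, hrun, hS⟩ := UGFull.run_program I hk1 hs
    (UGFull.word_size n q k s hn hk1 hs hc)
  rw [hrun]
  obtain ⟨x, hx⟩ := I.exists_card_violated_eq_opt
  have hxmin : ∀ y, I.cost x ≤ I.cost y := by
    intro y
    rw [I.cost_eq_two_mul_card, I.cost_eq_two_mul_card, hx]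
    exact Nat.mul_le_mul_left 2 (I.opt_le y)
  obtain ⟨A, hA, hgood⟩ := I.exists_good_samples x hxmin k s hk1 hs
  constructor
  · intro F hF
    obtain ⟨ω, -, rfl⟩ := (PMF.mem_support_map_iff _ _ _).1 hF
    obtain ⟨y, hy, -⟩ := (hS ω).1
    exact ⟨y, rfl, hy⟩
  · rw [PMF.toOuterMeasure_map_apply]
    have hsub : (A : Set _) ⊆ (fun ω => (([], S ω) : UGFull.Config)) ⁻¹'
        {F | ∃ x : Fin n → Fin q, UGFull.Outputs F x ∧
          ((I.violated x).card : ℝ) ≤ (1 + τ) * (I.opt : ℝ)} := by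
      intro ω hω
      obtain ⟨⟨y, hy, hcost⟩, hpiv, hsam⟩ := hS ω
      refine ⟨y, ⟨rfl, hy⟩, ?_⟩
      have h1 := (Nat.mul_le_mul_left k hcost).trans (hgood ω hω _ hpiv hsam)
      rw [I.cost_eq_two_mul_card, I.cost_eq_two_mul_card, hx] at h1
      have h2 : (k : ℝ) * (I.violated y).card ≤ (k + 1) * I.opt := by
        have : k * (I.violated y).card ≤ (k + 1) * I.opt := by nlinarith
        exact_mod_cast this
      have hkpos : (0 : ℝ) < k := by exact_mod_cast hk1
      have hkτ : 1 ≤ k * τ := by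
        have : 1 / τ ≤ k := Nat.le_ceil _
        rwa [div_le_iff₀ hτ] at this
      have h3 : (k : ℝ) * (I.violated y).card ≤ k * ((1 + τ) * I.opt) := by
        have : (1 : ℝ) * I.opt ≤ (k * τ) * I.opt := by gcongr
        linarith
      exact le_of_mul_le_mul_left h3 hkpos
    refine le_trans ?_ (MeasureTheory.measure_mono hsub)
    rw [PMF.toOuterMeasure_uniformOfFintype_apply]
    have hcard : (Fintype.card (A : Set ((Fin (s ^ 3) → Fin n) × (Fin n → Fin (s ^ 3))))) =
        A.card := by simp
    rw [hcard, ENNReal.le_div_iff_mul_le (Or.inl (Nat.cast_ne_zero.2 Fintype.card_ne_zero)) (Or.inl (ENNReal.natCast_ne_top _)),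
      div_eq_mul_inv, mul_right_comm, ← div_eq_mul_inv,
      ENNReal.div_le_iff_le_mul (Or.inl (by norm_num)) (Or.inl (by norm_num)), mul_comm _ (3 : ENNReal)]
    exact_mod_cast hA
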